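/- Let $U\subset\mathbb R^2$ be a nonempty connected open set with coordinates $u^1,u^2$, let $g^{ij}$ and $\Gamma^{ij}_k$ ($i,j,k\in\{1,2\}$) be smooth real functions on $U$, and consider the first-order homogeneous matrix differential operator $$P_1=g^{ij}(u)\,\partial_x+\Gamma^{ij}_k(u)\,u^k_x ,\qquad\text{and}\qquad R_3^{(1)}=\begin{pmatrix}0&1\\1&0\end{pmatrix}\partial_x^3 .$$ An operator $P$ is called Hamiltonian if it is formally skew-adjoint and the bracket $\{F,G\}=\int \frac{\delta F}{\delta u^i}P^{ij}\frac{\delta G}{\delta u^j}\,dx$ satisfies the Jacobi identity (that is, the Schouten bracket $[P,P]$ vanishes), and two operators are called compatible if all their linear combinations are Hamiltonian. (a) $P_1$ is Hamiltonian and compatible with $R_3^{(1)}$ if and only if $\Gamma^{ij}_k=\tfrac12\,\partial g^{ij}/\partial u^k$ on $U$ for all $i,j,k$ and there are real constants $c_1,\dots,c_7$ such that on $U$ $$g^{11}=c_1u^1+c_2u^2+c_3,\qquad g^{12}=g^{21}=c_4u^1+c_1u^2+c_5,\qquad g^{22}=c_6u^1+c_4u^2+c_7,$$ and $$c_1c_4-c_2c_6=0,\qquad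 c_3c_4-c_7c_2=0,\qquad c_3c_6-c_1c_7=0 .$$ (b) Suppose that $\det(g^{ij})\neq0$ everywhere on $U$. Then $P_1$ is Hamiltonian and compatible with $R_3^{(1)}$ if and only if $\Gamma^{ij}_k=-g^{il}\Gamma^j_{lk}$, where $\Gamma^j_{lk}$ are the Christoffel symbols of the Levi-Civita connection of the metric $(g_{ij})=(g^{ij})^{-1}$, and there are real constants $c_1,\dots,c_7$ for which $g^{ij}$ has the form displayed in (a) and the three quadratic conditions in (a) hold. -/

import Mathlib

open scoped ContDiff

noncomputable section

namespace KdVType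

/-- An operator depending on the field: `P u ξ` is the image of the covector field `ξ = (ξ_j(x))`
under the operator `P_u` attached to the field configuration `u = (u^i(x))`, `x ∈ ℝ`. -/
abbrev FieldOperator (m : ℕ) : Type :=
  (ℝ → Fin m → ℝ) → (ℝ → Fin m → ℝ) → (ℝ → Fin m → ℝ)

/-- Smooth field configurations with values in the domain `U` of the dependent variables. -/
structure IsField {m : ℕ} (U : Set (Fin m → ℝ)) (u : ℝ → Fin m → ℝ) : Prop where
  smooth : ContDiff ℝ ∞ u
  mem : ∀ x, u x ∈ U

/-- Test covector fields: smooth with compact support. -/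
structure IsTest {m : ℕ} (ξ : ℝ → Fin m → ℝ) : Prop where
  smooth : ContDiff ℝ ∞ ξ
  compact : HasCompactSupport ξ

/-- The pairing `∫ ξ_i(x) X^i(x) dx`. -/
def pairing {m : ℕ} (ξ X : ℝ → Fin m → ℝ) : ℝ :=
  ∫ x, ∑ i, ξ x i * X x i

/-- The derivative of `u ↦ P_u ξ` at `u` in the direction `v`:
`(DP_u[v] ξ)^i(x) = d/dε (P_{u + ε v} ξ)^i(x)` at `ε = 0`. -/
def FieldOperator.lin {m : ℕ} (P : FieldOperator m) (u v ξ : ℝ → Fin m → ℝ) :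
    ℝ → Fin m → ℝ :=
  fun x i => deriv (fun ε : ℝ => P (u + ε • v) ξ x i) 0

/-- `P` is a Hamiltonian operator on fields with values in `U`: it is formally skew-adjoint, and
the bracket `{F, G} = ∫ (δF/δu^i) P^{ij} (δG/δu^j) dx` satisfies the Jacobi identity, that is, the
Schouten bracket `[P, P]`, as a functional trivector, vanishes identically. -/
structure IsHamiltonian {m : ℕ} (U : Set (Fin m → ℝ)) (P : FieldOperator m) : Prop where
  skew : ∀ u ξ η, IsField U u → IsTest ξ → IsTest η →
    pairing ξ (P u η) = - pairing η (P u ξ)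
  jacobi : ∀ u ξ η ζ, IsField U u → IsTest ξ → IsTest η → IsTest ζ →
    pairing ξ (P.lin u (P u ζ) η) + pairing η (P.lin u (P u ξ) ζ)
      + pairing ζ (P.lin u (P u η) ξ) = 0

/-- Compatibility: every linear combination of the two operators is Hamiltonian. -/
def AreCompatible {m : ℕ} (U : Set (Fin m → ℝ)) (P Q : FieldOperator m) : Prop :=
  ∀ a b : ℝ, IsHamiltonian U (a • P + b • Q)

/-- The first-order homogeneous operator `g^{ij}(u) ∂_x + Γ^{ij}_k(u) u^k_x`;
here `g u i j = g^{ij}(u)` and `Γ u i j k = Γ^{ij}_k(u)`. -/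
def hydroOp {m : ℕ} (g : (Fin m → ℝ) → Matrix (Fin m) (Fin m) ℝ)
    (Γ : (Fin m → ℝ) → Fin m → Fin m → Fin m → ℝ) : FieldOperator m :=
  fun u ξ x i => ∑ j, (g (u x) i j * deriv (fun y => ξ y j) x
    + (∑ k, Γ (u x) i j k * deriv (fun y => u y k) x) * ξ x j)

/-- The operator `A ∂_x^n` with a constant matrix `A`. -/
def constOp {m : ℕ} (A : Matrix (Fin m) (Fin m) ℝ) (n : ℕ) : FieldOperator m :=
  fun _ ξ x i => ∑ j, A i j * iteratedDeriv n (fun y => ξ y j) x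

/-- The third-order operator with matrix `[[0, 1], [1, 0]]` times `∂_x^3`. -/
def R31 : FieldOperator 2 := constOp !![0, 1; 1, 0] 3

/-- The partial derivative `∂f/∂u^k` at the point `u`. -/
def partialD {m : ℕ} (k : Fin m) (f : (Fin m → ℝ) → ℝ) (u : Fin m → ℝ) : ℝ :=
  fderiv ℝ f u (Pi.single k 1)

/-- The Christoffel symbols `Γ^j_{lk}` of the Levi-Civita connection of the metric `g_{ij}`,
the inverse of the contravariant metric `g^{ij}`. -/
def christoffel {m : ℕ} (g : (Fin m → ℝ) → Matrix (Fin m) (Fin m) ℝ)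
    (u : Fin m → ℝ) (j l k : Fin m) : ℝ :=
  (1 / 2) * ∑ s, g u j s *
    (partialD l (fun w => (g w)⁻¹ s k) u + partialD k (fun w => (g w)⁻¹ s l) u
      - partialD s (fun w => (g w)⁻¹ l k) u)

/-- The contravariant Christoffel symbols `Γ^{ij}_k = - g^{il} Γ^j_{lk}`. -/
def contraChristoffel {m : ℕ} (g : (Fin m → ℝ) → Matrix (Fin m) (Fin m) ℝ)
    (u : Fin m → ℝ) (i j k : Fin m) : ℝ :=
  - ∑ l, g u i l * christoffel g u j l k

end KdVType

end

/-!
The proof tests the defining identities of a Hamiltonian operator on well-chosen fields, and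
conversely exhibits the integrands of these identities as total derivatives.

The linearisation of an operator does not see the constant operator `R`, so compatibility of `P₁`
and `R` amounts to skew-adjointness, the Jacobi identity for `P₁`, and a mixed identity linear in
`R` (`schouten_of_areCompatible`). As the operators are local, two of the three arguments of the
latter two identities may be arbitrary smooth functions, for instance polynomials, as long as the
third has compact support (`schouten_eq_zero_of_smooth`). Only integrals of the form
`∫ xⁿ φ⁽ⁿ⁾ = (-1)ⁿ n! ∫ φ` then have to be computed.

*Necessity.* Along constant fields, the mixed identity gives `Γ^{ij}_k = ½ ∂_k g^{ij}` and the
total symmetry of `∂_k g^{ij} R^{kl}` (`third_order_conditions`), and the Jacobi identity gives the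
total symmetry of `∂_k g^{ij} g^{kl}` (`first_order_condition`). Along an arbitrary field `u`, the
mixed identity says that `b = (∂_k g^{ij} R^{kl}) ∘ u` satisfies `∫ b φ''' = 0` for all test
functions `φ`, so that `b''' = 0`. If `u` is constant outside a compact set this forces `b` to be
constant; hence the derivatives of `g` are constant (`sum_partialD_eq`) and `g` is affine. In two
dimensions the two symmetries are the linear relations between the coefficients of `g` and the
three quadratic constraints.

*Sufficiency.* If `g` is affine and both tensors are totally symmetric, the sum of the three
integrands of the Jacobi identity is, up to an explicit total derivative, a contraction of the
tensors with expressions in the jets of the test fields whose cyclic sum vanishes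
(`jacobi_combination`).

Finally, when `g` is invertible, the symmetry of `∂_k g^{ij} g^{kl}` is what makes the
contravariant Christoffel symbols equal to `½ ∂_k g^{ij}` (`contraChristoffel_eq`), so the two
characterisations agree.
-/

namespace KdVType

open Filter Topology MeasureTheory

/-! ### Local operators and cut-offs -/

/-- An operator is local if the value of `P u ξ` at `x` depends only on the germs of `u` and `ξ`
at `x`, and vanishes for `ξ = 0`. -/
structure IsLocal {m : ℕ} (P : FieldOperator m) : Prop where
  congr : ∀ {u u' ξ ξ' : ℝ → Fin m → ℝ} {x : ℝ}, u =ᶠ[𝓝 x] u' → ξ =ᶠ[𝓝 x] ξ' →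
    P u ξ x = P u' ξ' x
  map_zero : ∀ u, P u 0 = 0

theorem IsLocal.eventuallyEq {m : ℕ} {P : FieldOperator m} (hP : IsLocal P)
    {u u' ξ ξ' : ℝ → Fin m → ℝ} {x : ℝ} (hu : u =ᶠ[𝓝 x] u') (hξ : ξ =ᶠ[𝓝 x] ξ') :
    P u ξ =ᶠ[𝓝 x] P u' ξ' := by
  filter_upwards [hu.eventuallyEq_nhds, hξ.eventuallyEq_nhds] with y h1 h2 using hP.congr h1 h2

theorem IsLocal.lin_congr {m : ℕ} {P : FieldOperator m} (hP : IsLocal P)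
    {u v v' ξ ξ' : ℝ → Fin m → ℝ} {x : ℝ} (hv : v =ᶠ[𝓝 x] v') (hξ : ξ =ᶠ[𝓝 x] ξ') :
    P.lin u v ξ x = P.lin u v' ξ' x := by
  funext i
  have h : ∀ ε : ℝ, P (u + ε • v) ξ x = P (u + ε • v') ξ' x := fun ε =>
    hP.congr ((EventuallyEq.refl _ u).add (hv.const_smul ε)) hξ
  simp only [FieldOperator.lin, h]

theorem FieldOperator.lin_zero_direction {m : ℕ} (P : FieldOperator m) (u ξ : ℝ → Fin m → ℝ) :
    P.lin u 0 ξ = 0 := by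
  funext x i
  simp [FieldOperator.lin]

theorem IsLocal.lin_zero {m : ℕ} {P : FieldOperator m} (hP : IsLocal P) (u v : ℝ → Fin m → ℝ) :
    P.lin u v 0 = 0 := by
  funext x i
  simp [FieldOperator.lin, hP.map_zero]

/-- The cyclic sum whose vanishing, for `Q = P`, is the Jacobi identity for `P`. -/
noncomputable def schouten {m : ℕ} (P Q : FieldOperator m) (u ξ η ζ : ℝ → Fin m → ℝ) : ℝ :=
  pairing ξ (P.lin u (Q u ζ) η) + pairing η (P.lin u (Q u ξ) ζ) + pairing ζ (P.lin u (Q u η) ξ)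

/-- Every compactly supported function admits a smooth compactly supported cut-off, equal to `1`
near its support. -/
theorem exists_cutoff {E : Type*} [Zero E] {ζ : ℝ → E} (hζ : HasCompactSupport ζ) :
    ∃ χ : ℝ → ℝ, ContDiff ℝ ∞ χ ∧ HasCompactSupport χ ∧ ∀ x ∈ tsupport ζ, χ =ᶠ[𝓝 x] 1 := by
  obtain ⟨R, hR⟩ := (hζ.isCompact.isBounded).subset_ball (0 : ℝ)
  let χ : ContDiffBump (0 : ℝ) := ⟨max R 1, max R 1 + 1, by positivity, by linarith⟩
  refine ⟨χ, χ.contDiff, χ.hasCompactSupport, fun x hx => ?_⟩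
  refine χ.eventuallyEq_one_of_mem_ball ?_
  exact Metric.ball_subset_ball (le_max_left R 1) (hR hx)

theorem smul_isTest {m : ℕ} {χ : ℝ → ℝ} {ξ : ℝ → Fin m → ℝ} (hχ : ContDiff ℝ ∞ χ)
    (hχc : HasCompactSupport χ) (hξ : ContDiff ℝ ∞ ξ) : IsTest (fun x => χ x • ξ x) :=
  ⟨hχ.smul hξ, hχc.smul_right⟩

theorem smul_eventuallyEq {m : ℕ} {χ : ℝ → ℝ} {x : ℝ} (hχ : χ =ᶠ[𝓝 x] 1) (ξ : ℝ → Fin m → ℝ) :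
    (fun y => χ y • ξ y) =ᶠ[𝓝 x] ξ := by
  filter_upwards [hχ] with y hy
  simp [hy]

theorem pairing_congr {m : ℕ} {ξ ξ' X X' : ℝ → Fin m → ℝ}
    (h : ∀ x, (∑ i, ξ x i * X x i) = ∑ i, ξ' x i * X' x i) : pairing ξ X = pairing ξ' X' := by
  simp only [pairing, h]

/-- For local operators the cyclic sum only sees two of its arguments near the support of the
third; hence identities valid for test fields persist when two of them are merely smooth. -/
theorem schouten_eq_zero_of_smooth {m : ℕ} {P Q : FieldOperator m} (hP : IsLocal P)
    (hQ : IsLocal Q) {u : ℝ → Fin m → ℝ}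
    (h : ∀ ξ η ζ, IsTest ξ → IsTest η → IsTest ζ → schouten P Q u ξ η ζ = 0)
    {ξ η ζ : ℝ → Fin m → ℝ} (hξ : ContDiff ℝ ∞ ξ) (hη : ContDiff ℝ ∞ η) (hζ : IsTest ζ) :
    schouten P Q u ξ η ζ = 0 := by
  obtain ⟨χ, hχ, hχc, hχ1⟩ := exists_cutoff hζ.compact
  rw [← h _ _ ζ (smul_isTest hχ hχc hξ) (smul_isTest hχ hχc hη) hζ]
  have hQ0 : ∀ x, x ∉ tsupport ζ → Q u ζ =ᶠ[𝓝 x] 0 := fun x hx => by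
    have h0 := hQ.eventuallyEq (EventuallyEq.refl _ u) (notMem_tsupport_iff_eventuallyEq.1 hx)
    rwa [hQ.map_zero] at h0
  have hval : ∀ x ∈ tsupport ζ, χ x = 1 := fun x hx => (hχ1 x hx).eq_of_nhds
  unfold schouten
  congr 1
  congr 1
  · refine pairing_congr fun x => ?_
    by_cases hx : x ∈ tsupport ζ
    · rw [hP.lin_congr (EventuallyEq.refl _ _) (smul_eventuallyEq (hχ1 x hx) η)]
      simp [hval x hx]
    · rw [hP.lin_congr (hQ0 x hx) (EventuallyEq.refl _ _),
        hP.lin_congr (ξ' := fun y => χ y • η y) (hQ0 x hx) (EventuallyEq.refl _ _),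
        P.lin_zero_direction, P.lin_zero_direction]
      simp
  · refine pairing_congr fun x => ?_
    by_cases hx : x ∈ tsupport ζ
    · rw [hP.lin_congr (hQ.eventuallyEq (EventuallyEq.refl _ u) (smul_eventuallyEq (hχ1 x hx) ξ))
        (EventuallyEq.refl _ _)]
      simp [hval x hx]
    · have h0 := notMem_tsupport_iff_eventuallyEq.1 hx
      rw [hP.lin_congr (EventuallyEq.refl _ (Q u ξ)) h0,
        hP.lin_congr (EventuallyEq.refl _ (Q u fun y => χ y • ξ y)) h0, hP.lin_zero, hP.lin_zero]
      simp
  · refine pairing_congr fun x => ?_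
    by_cases hx : x ∈ tsupport ζ
    · rw [hP.lin_congr (hQ.eventuallyEq (EventuallyEq.refl _ u) (smul_eventuallyEq (hχ1 x hx) η))
        (smul_eventuallyEq (hχ1 x hx) ξ)]
    · simp [image_eq_zero_of_notMem_tsupport hx]

/-- Formal skew-adjointness extends to pairs of which only one member has compact support. -/
theorem skew_of_smooth {m : ℕ} {P : FieldOperator m} (hP : IsLocal P) {u : ℝ → Fin m → ℝ}
    (h : ∀ ξ η, IsTest ξ → IsTest η → pairing ξ (P u η) = - pairing η (P u ξ))
    {ξ ζ : ℝ → Fin m → ℝ} (hξ : ContDiff ℝ ∞ ξ) (hζ : IsTest ζ) :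
    pairing ζ (P u ξ) = - pairing ξ (P u ζ) := by
  obtain ⟨χ, hχ, hχc, hχ1⟩ := exists_cutoff hζ.compact
  have hval : ∀ x ∈ tsupport ζ, χ x = 1 := fun x hx => (hχ1 x hx).eq_of_nhds
  have key := h ζ _ hζ (smul_isTest hχ hχc hξ)
  have h1 : pairing ζ (P u fun x => χ x • ξ x) = pairing ζ (P u ξ) := by
    refine pairing_congr fun x => ?_
    by_cases hx : x ∈ tsupport ζ
    · rw [hP.congr (EventuallyEq.refl _ u) (smul_eventuallyEq (hχ1 x hx) ξ)]
    · simp [image_eq_zero_of_notMem_tsupport hx]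
  have h2 : pairing (fun x => χ x • ξ x) (P u ζ) = pairing ξ (P u ζ) := by
    refine pairing_congr fun x => ?_
    by_cases hx : x ∈ tsupport ζ
    · simp [hval x hx]
    · rw [hP.congr (EventuallyEq.refl _ u) (notMem_tsupport_iff_eventuallyEq.1 hx), hP.map_zero]
      simp
  rw [← h1, key, h2]

theorem eventuallyEq_apply {m : ℕ} {ξ ξ' : ℝ → Fin m → ℝ} {x : ℝ} (h : ξ =ᶠ[𝓝 x] ξ')
    (j : Fin m) : (fun y => ξ y j) =ᶠ[𝓝 x] fun y => ξ' y j := by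
  filter_upwards [h] with y hy
  rw [hy]

theorem isLocal_hydroOp {m : ℕ} (g : (Fin m → ℝ) → Matrix (Fin m) (Fin m) ℝ)
    (Γ : (Fin m → ℝ) → Fin m → Fin m → Fin m → ℝ) : IsLocal (hydroOp g Γ) where
  congr := by
    intro u u' ξ ξ' x hu hξ
    funext i
    have h1 := fun k => (eventuallyEq_apply hu k).deriv_eq
    have h2 := fun k => (eventuallyEq_apply hξ k).deriv_eq
    simp only [hydroOp, hu.eq_of_nhds, hξ.eq_of_nhds, h1, h2]
  map_zero := by
    intro u
    funext x i
    simp [hydroOp]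

theorem isLocal_constOp {m : ℕ} (A : Matrix (Fin m) (Fin m) ℝ) (n : ℕ) :
    IsLocal (constOp A n) where
  congr := by
    intro u u' ξ ξ' x hu hξ
    funext i
    have h2 := fun k => (eventuallyEq_apply hξ k).iteratedDeriv_eq n
    simp only [constOp, h2]
  map_zero := by
    intro u
    funext x i
    simp [constOp]

/-! ### The linearisation of a first-order operator -/

theorem IsField.apply {m : ℕ} {U : Set (Fin m → ℝ)} {u : ℝ → Fin m → ℝ} (hu : IsField U u)
    (k : Fin m) : ContDiff ℝ ∞ fun x => u x k :=
  contDiff_pi.1 hu.smooth k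

theorem contDiff_deriv {f : ℝ → ℝ} (hf : ContDiff ℝ ∞ f) : ContDiff ℝ ∞ (deriv f) :=
  (contDiff_infty_iff_deriv.1 hf).2

theorem contDiff_iteratedDeriv {f : ℝ → ℝ} (hf : ContDiff ℝ ∞ f) (n : ℕ) :
    ContDiff ℝ ∞ (iteratedDeriv n f) := by
  induction n with
  | zero => simpa using hf
  | succ n ih => rw [iteratedDeriv_succ]; exact contDiff_deriv ih

theorem contDiff_comp_field {m : ℕ} {U : Set (Fin m → ℝ)} {u : ℝ → Fin m → ℝ}
    (hu : IsField U u) {f : (Fin m → ℝ) → ℝ} (hf : ContDiffOn ℝ ∞ f U) :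
    ContDiff ℝ ∞ fun x => f (u x) :=
  hf.comp_contDiff hu.smooth hu.mem

theorem contDiff_hydroOp {m : ℕ} {U : Set (Fin m → ℝ)}
    {g : (Fin m → ℝ) → Matrix (Fin m) (Fin m) ℝ} {Γ : (Fin m → ℝ) → Fin m → Fin m → Fin m → ℝ}
    (hg : ∀ i j, ContDiffOn ℝ ∞ (fun u => g u i j) U)
    (hΓ : ∀ i j k, ContDiffOn ℝ ∞ (fun u => Γ u i j k) U) {u ξ : ℝ → Fin m → ℝ}
    (hu : IsField U u) (hξ : ContDiff ℝ ∞ ξ) : ContDiff ℝ ∞ (hydroOp g Γ u ξ) := by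
  refine contDiff_pi.2 fun i => ?_
  unfold hydroOp
  refine ContDiff.sum fun j _ => ContDiff.add ?_ ?_
  · exact (contDiff_comp_field hu (hg i j)).mul (contDiff_deriv (contDiff_pi.1 hξ j))
  · refine ContDiff.mul (ContDiff.sum fun k _ => ?_) (contDiff_pi.1 hξ j)
    exact (contDiff_comp_field hu (hΓ i j k)).mul (contDiff_deriv (hu.apply k))

theorem contDiff_constOp {m : ℕ} (A : Matrix (Fin m) (Fin m) ℝ) (n : ℕ) (u : ℝ → Fin m → ℝ)
    {ξ : ℝ → Fin m → ℝ} (hξ : ContDiff ℝ ∞ ξ) : ContDiff ℝ ∞ (constOp A n u ξ) := by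
  refine contDiff_pi.2 fun i => ?_
  unfold constOp
  exact ContDiff.sum fun j _ =>
    contDiff_const.mul (contDiff_iteratedDeriv (contDiff_pi.1 hξ j) n)

/-- The derivative of `f` in the direction `v` in terms of partial derivatives. -/
theorem fderiv_eq_sum_partialD {m : ℕ} (f : (Fin m → ℝ) → ℝ) (w v : Fin m → ℝ) :
    fderiv ℝ f w v = ∑ l, partialD l f w * v l := by
  conv_lhs => rw [pi_eq_sum_univ' v]
  simp [partialD, mul_comm, Pi.single]

theorem contDiffOn_partialD {m : ℕ} {U : Set (Fin m → ℝ)} (hU : IsOpen U)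
    {f : (Fin m → ℝ) → ℝ} (hf : ContDiffOn ℝ ∞ f U) (k : Fin m) :
    ContDiffOn ℝ ∞ (partialD k f) U :=
  (hf.fderiv_of_isOpen hU (by simp)).clm_apply contDiffOn_const

theorem differentiableAt_of_contDiffOn {m : ℕ} {U : Set (Fin m → ℝ)} (hU : IsOpen U)
    {f : (Fin m → ℝ) → ℝ} (hf : ContDiffOn ℝ ∞ f U) {w : Fin m → ℝ} (hw : w ∈ U) :
    DifferentiableAt ℝ f w :=
  (hf.contDiffAt (hU.mem_nhds hw)).differentiableAt (by simp)

theorem hasDerivAt_comp_line {m : ℕ} {U : Set (Fin m → ℝ)} (hU : IsOpen U)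
    {f : (Fin m → ℝ) → ℝ} (hf : ContDiffOn ℝ ∞ f U) {w : Fin m → ℝ} (hw : w ∈ U)
    (v : Fin m → ℝ) :
    HasDerivAt (fun ε : ℝ => f (w + ε • v)) (∑ l, partialD l f w * v l) 0 := by
  rw [← fderiv_eq_sum_partialD]
  have h1 : HasDerivAt (fun ε : ℝ => w + ε • v) v 0 := by
    simpa using ((hasDerivAt_id (0 : ℝ)).smul_const v).const_add w
  have h2 : HasFDerivAt f (fderiv ℝ f w) (w + (0 : ℝ) • v) := by
    simpa using (differentiableAt_of_contDiffOn hU hf hw).hasFDerivAt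
  exact h2.comp_hasDerivAt 0 h1

/-- The chain rule along a field. -/
theorem deriv_comp_field {m : ℕ} {U : Set (Fin m → ℝ)} (hU : IsOpen U) {u : ℝ → Fin m → ℝ}
    (hu : IsField U u) {f : (Fin m → ℝ) → ℝ} (hf : ContDiffOn ℝ ∞ f U) (x : ℝ) :
    deriv (fun y => f (u y)) x = ∑ k, partialD k f (u x) * deriv (fun y => u y k) x := by
  have hd : HasDerivAt u (fun k => deriv (fun y => u y k) x) x :=
    hasDerivAt_pi.2 fun k => ((hu.apply k).differentiable (by simp) x).hasDerivAt
  rw [← fderiv_eq_sum_partialD]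
  exact ((differentiableAt_of_contDiffOn hU hf (hu.mem x)).hasFDerivAt.comp_hasDerivAt x hd).deriv

theorem lin_hydroOp {m : ℕ} {U : Set (Fin m → ℝ)} (hU : IsOpen U)
    {g : (Fin m → ℝ) → Matrix (Fin m) (Fin m) ℝ} {Γ : (Fin m → ℝ) → Fin m → Fin m → Fin m → ℝ}
    (hg : ∀ i j, ContDiffOn ℝ ∞ (fun u => g u i j) U)
    (hΓ : ∀ i j k, ContDiffOn ℝ ∞ (fun u => Γ u i j k) U) {u v : ℝ → Fin m → ℝ}
    (hu : IsField U u) (hv : ContDiff ℝ ∞ v) (ξ : ℝ → Fin m → ℝ) (x : ℝ) (i : Fin m) :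
    (hydroOp g Γ).lin u v ξ x i =
      ∑ j, ((∑ l, partialD l (fun w => g w i j) (u x) * v x l) * deriv (fun y => ξ y j) x
        + (∑ k, ((∑ l, partialD l (fun w => Γ w i j k) (u x) * v x l) * deriv (fun y => u y k) x
            + Γ (u x) i j k * deriv (fun y => v y k) x)) * ξ x j) := by
  have hx := hu.mem x
  have hdu : ∀ (k : Fin m) (ε : ℝ), deriv (fun y => (u + ε • v) y k) x =
      deriv (fun y => u y k) x + ε * deriv (fun y => v y k) x := fun k ε => by
    have h1 : DifferentiableAt ℝ (fun y => u y k) x := (hu.apply k).differentiable (by simp) x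
    have h2 : DifferentiableAt ℝ (fun y => v y k) x :=
      (contDiff_pi.1 hv k).differentiable (by simp) x
    simpa using (h1.hasDerivAt.fun_add (h2.hasDerivAt.const_mul ε)).deriv
  have hlin : ∀ k, HasDerivAt (fun ε : ℝ => deriv (fun y => u y k) x
      + ε * deriv (fun y => v y k) x) (deriv (fun y => v y k) x) 0 := fun k => by
    simpa using ((hasDerivAt_id (0 : ℝ)).mul_const (deriv (fun y => v y k) x)).const_add
      (deriv (fun y => u y k) x)
  unfold FieldOperator.lin
  refine HasDerivAt.deriv ?_
  simp only [hydroOp, hdu]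
  refine HasDerivAt.fun_sum fun j _ => HasDerivAt.add ?_ ?_
  · exact (hasDerivAt_comp_line hU (hg i j) hx (v x)).mul_const _
  · refine HasDerivAt.mul_const (HasDerivAt.fun_sum fun k _ => ?_) _
    simpa using (hasDerivAt_comp_line hU (hΓ i j k) hx (v x)).fun_mul (hlin k)

theorem contDiff_lin_hydroOp {m : ℕ} {U : Set (Fin m → ℝ)} (hU : IsOpen U)
    {g : (Fin m → ℝ) → Matrix (Fin m) (Fin m) ℝ} {Γ : (Fin m → ℝ) → Fin m → Fin m → Fin m → ℝ}
    (hg : ∀ i j, ContDiffOn ℝ ∞ (fun u => g u i j) U)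
    (hΓ : ∀ i j k, ContDiffOn ℝ ∞ (fun u => Γ u i j k) U) {u v ξ : ℝ → Fin m → ℝ}
    (hu : IsField U u) (hv : ContDiff ℝ ∞ v) (hξ : ContDiff ℝ ∞ ξ) :
    ContDiff ℝ ∞ ((hydroOp g Γ).lin u v ξ) := by
  refine contDiff_pi.2 fun i => ?_
  simp only [lin_hydroOp hU hg hΓ hu hv]
  have hp : ∀ {f : (Fin m → ℝ) → ℝ} (l), ContDiffOn ℝ ∞ f U →
      ContDiff ℝ ∞ fun x => partialD l f (u x) := fun l hf =>
    contDiff_comp_field hu (contDiffOn_partialD hU hf l)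
  refine ContDiff.sum fun j _ => ContDiff.add ?_ ?_
  · exact (ContDiff.sum fun l _ => (hp l (hg i j)).mul (contDiff_pi.1 hv l)).mul
      (contDiff_deriv (contDiff_pi.1 hξ j))
  · refine ContDiff.mul (ContDiff.sum fun k _ => ContDiff.add ?_ ?_) (contDiff_pi.1 hξ j)
    · exact (ContDiff.sum fun l _ => (hp l (hΓ i j k)).mul (contDiff_pi.1 hv l)).mul
        (contDiff_deriv (hu.apply k))
    · exact (contDiff_comp_field hu (hΓ i j k)).mul (contDiff_deriv (contDiff_pi.1 hv k))

/-- The linearisation does not see a summand that is independent of the field. -/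
theorem lin_smul_add_constOp {m : ℕ} (P : FieldOperator m) (A : Matrix (Fin m) (Fin m) ℝ) (n : ℕ)
    (a b : ℝ) (u v ξ : ℝ → Fin m → ℝ) :
    (a • P + b • constOp A n).lin u v ξ = a • P.lin u v ξ := by
  funext x i
  simp [FieldOperator.lin, constOp]

theorem lin_hydroOp_add {m : ℕ} {U : Set (Fin m → ℝ)} (hU : IsOpen U)
    {g : (Fin m → ℝ) → Matrix (Fin m) (Fin m) ℝ} {Γ : (Fin m → ℝ) → Fin m → Fin m → Fin m → ℝ}
    (hg : ∀ i j, ContDiffOn ℝ ∞ (fun u => g u i j) U)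
    (hΓ : ∀ i j k, ContDiffOn ℝ ∞ (fun u => Γ u i j k) U) {u v v' : ℝ → Fin m → ℝ}
    (hu : IsField U u) (hv : ContDiff ℝ ∞ v) (hv' : ContDiff ℝ ∞ v') (ξ : ℝ → Fin m → ℝ) :
    (hydroOp g Γ).lin u (v + v') ξ = (hydroOp g Γ).lin u v ξ + (hydroOp g Γ).lin u v' ξ := by
  funext x i
  have hd : ∀ k, deriv (fun y => v y k + v' y k) x =
      deriv (fun y => v y k) x + deriv (fun y => v' y k) x := fun k =>
    deriv_fun_add ((contDiff_pi.1 hv k).differentiable (by simp) x)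
      ((contDiff_pi.1 hv' k).differentiable (by simp) x)
  change _ = (hydroOp g Γ).lin u v ξ x i + (hydroOp g Γ).lin u v' ξ x i
  rw [lin_hydroOp hU hg hΓ (v := v + v') hu (hv.add hv'), lin_hydroOp hU hg hΓ hu hv,
    lin_hydroOp hU hg hΓ hu hv', ← Finset.sum_add_distrib]
  simp only [Pi.add_apply, hd]
  refine Finset.sum_congr rfl fun j _ => ?_
  simp only [mul_add, add_mul, Finset.sum_add_distrib]
  ring

theorem integrable_pairing {m : ℕ} {ξ X : ℝ → Fin m → ℝ} (hξ : IsTest ξ) (hX : ContDiff ℝ ∞ X) :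
    Integrable fun x => ∑ i, ξ x i * X x i := by
  refine integrable_finsetSum _ fun i _ => ?_
  refine Continuous.integrable_of_hasCompactSupport ?_ ?_
  · exact (contDiff_pi.1 hξ.smooth i).continuous.mul (contDiff_pi.1 hX i).continuous
  · exact (hξ.compact.comp_left (g := fun w : Fin m → ℝ => w i) rfl).mul_right

theorem pairing_add {m : ℕ} {ξ X Y : ℝ → Fin m → ℝ} (hξ : IsTest ξ) (hX : ContDiff ℝ ∞ X)
    (hY : ContDiff ℝ ∞ Y) : pairing ξ (X + Y) = pairing ξ X + pairing ξ Y := by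
  unfold pairing
  rw [← integral_add (integrable_pairing hξ hX) (integrable_pairing hξ hY)]
  simp [mul_add, Finset.sum_add_distrib]

/-- If a first-order operator is compatible with a constant-coefficient one, then both the Jacobi
identity for the former and the mixed identity hold. -/
theorem schouten_of_areCompatible {m : ℕ} {U : Set (Fin m → ℝ)} (hU : IsOpen U)
    {g : (Fin m → ℝ) → Matrix (Fin m) (Fin m) ℝ} {Γ : (Fin m → ℝ) → Fin m → Fin m → Fin m → ℝ}
    (hg : ∀ i j, ContDiffOn ℝ ∞ (fun u => g u i j) U)
    (hΓ : ∀ i j k, ContDiffOn ℝ ∞ (fun u => Γ u i j k) U) {A : Matrix (Fin m) (Fin m) ℝ} {n : ℕ}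
    (h : AreCompatible U (hydroOp g Γ) (constOp A n)) {u ξ η ζ : ℝ → Fin m → ℝ}
    (hu : IsField U u) (hξ : ContDiff ℝ ∞ ξ) (hη : ContDiff ℝ ∞ η) (hζ : IsTest ζ) :
    schouten (hydroOp g Γ) (hydroOp g Γ) u ξ η ζ = 0 ∧
      schouten (hydroOp g Γ) (constOp A n) u ξ η ζ = 0 := by
  have hPP : ∀ ξ η ζ, IsTest ξ → IsTest η → IsTest ζ →
      schouten (hydroOp g Γ) (hydroOp g Γ) u ξ η ζ = 0 := fun ξ η ζ hξ hη hζ => by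
    have := (h 1 0).jacobi u ξ η ζ hu hξ hη hζ
    simpa [schouten, lin_smul_add_constOp] using this
  have hPR : ∀ ξ η ζ, IsTest ξ → IsTest η → IsTest ζ →
      schouten (hydroOp g Γ) (constOp A n) u ξ η ζ = 0 := fun ξ η ζ hξ hη hζ => by
    have h1 := (h 1 1).jacobi u ξ η ζ hu hξ hη hζ
    have h0 := hPP ξ η ζ hξ hη hζ
    have hs : ∀ {ξ η ζ : ℝ → Fin m → ℝ}, IsTest ξ → IsTest η → IsTest ζ →
        pairing ξ ((hydroOp g Γ).lin u (hydroOp g Γ u ζ + constOp A n u ζ) η) =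
          pairing ξ ((hydroOp g Γ).lin u (hydroOp g Γ u ζ) η)
            + pairing ξ ((hydroOp g Γ).lin u (constOp A n u ζ) η) := fun hξ hη hζ => by
      have hP := contDiff_hydroOp hg hΓ hu hζ.smooth
      have hR := contDiff_constOp A n u hζ.smooth
      rw [lin_hydroOp_add hU hg hΓ hu hP hR, pairing_add hξ
        (contDiff_lin_hydroOp hU hg hΓ hu hP hη.smooth)
        (contDiff_lin_hydroOp hU hg hΓ hu hR hη.smooth)]
    simp only [lin_smul_add_constOp] at h1
    simp only [one_smul, Pi.add_apply] at h1
    rw [hs hξ hη hζ, hs hη hζ hξ, hs hζ hξ hη] at h1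
    unfold schouten at h0 ⊢
    linarith
  have hP := isLocal_hydroOp g Γ
  exact ⟨schouten_eq_zero_of_smooth hP hP hPP hξ hη hζ,
    schouten_eq_zero_of_smooth hP (isLocal_constOp A n) hPR hξ hη hζ⟩

/-! ### Moments of derivatives of test functions -/

theorem integrable_mul_of_compact {f φ : ℝ → ℝ} (hf : Continuous f) (hφ : Continuous φ)
    (hc : HasCompactSupport φ) : Integrable fun x => f x * φ x :=
  (hf.mul hφ).integrable_of_hasCompactSupport hc.mul_left

theorem contDiff_monomial (p : ℕ) : ContDiff ℝ ∞ fun x : ℝ => x ^ p :=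
  contDiff_id.pow p

theorem hasCompactSupport_iteratedDeriv {φ : ℝ → ℝ} (hc : HasCompactSupport φ) (n : ℕ) :
    HasCompactSupport (iteratedDeriv n φ) := by
  induction n with
  | zero => simpa using hc
  | succ n ih => rw [iteratedDeriv_succ]; exact ih.deriv

theorem integral_mul_deriv_of_compact {f φ : ℝ → ℝ} (hf : ContDiff ℝ ∞ f) (hφ : ContDiff ℝ ∞ φ)
    (hc : HasCompactSupport φ) : ∫ x, f x * deriv φ x = -∫ x, deriv f x * φ x := by
  have hf' := contDiff_deriv hf
  have hφ' := contDiff_deriv hφ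
  exact integral_mul_deriv_eq_deriv_mul_of_integrable
    (fun x _ => (hf.differentiable (by simp) x).hasDerivAt)
    (fun x _ => (hφ.differentiable (by simp) x).hasDerivAt)
    (integrable_mul_of_compact hf.continuous hφ'.continuous hc.deriv)
    (integrable_mul_of_compact hf'.continuous hφ.continuous hc)
    (integrable_mul_of_compact hf.continuous hφ.continuous hc)

theorem integral_pow_mul_iteratedDeriv {φ : ℝ → ℝ} (hφ : ContDiff ℝ ∞ φ)
    (hc : HasCompactSupport φ) (n : ℕ) :
    ∫ x, x ^ n * iteratedDeriv n φ x = (-1) ^ n * n.factorial * ∫ x, φ x := by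
  induction n with
  | zero => simp
  | succ n ih =>
    rw [iteratedDeriv_succ, integral_mul_deriv_of_compact (contDiff_monomial (n + 1))
      (contDiff_iteratedDeriv hφ n) (hasCompactSupport_iteratedDeriv hc n)]
    simp only [deriv_pow_field, Nat.add_sub_cancel, mul_assoc]
    rw [integral_const_mul, ih, Nat.factorial_succ]
    push_cast
    ring

/-- A test function of non-zero integral. -/
theorem exists_integral_ne_zero :
    ∃ φ : ℝ → ℝ, ContDiff ℝ ∞ φ ∧ HasCompactSupport φ ∧ ∫ x, φ x ≠ 0 := by
  let χ : ContDiffBump (0 : ℝ) := ⟨1, 2, by norm_num, by norm_num⟩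
  exact ⟨χ, χ.contDiff, χ.hasCompactSupport, χ.integral_pos.ne'⟩

/-! ### Necessary conditions from constant fields -/

/-- The covector field with `i`-th component `α` and all other components zero. -/
def component {m : ℕ} (i : Fin m) (α : ℝ → ℝ) : ℝ → Fin m → ℝ :=
  fun x j => if j = i then α x else 0

theorem contDiff_component {m : ℕ} (i : Fin m) {α : ℝ → ℝ} (hα : ContDiff ℝ ∞ α) :
    ContDiff ℝ ∞ (component i α) :=
  contDiff_pi.2 fun j => by
    by_cases h : j = i
    · simpa [component, h] using hα
    · simpa [component, h] using contDiff_const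

theorem isTest_component {m : ℕ} (i : Fin m) {α : ℝ → ℝ} (hα : ContDiff ℝ ∞ α)
    (hc : HasCompactSupport α) : IsTest (component i α) where
  smooth := contDiff_component i hα
  compact := by
    refine hc.comp_left (g := fun (a : ℝ) (j : Fin m) => if j = i then a else 0) ?_
    funext j
    simp

theorem iteratedDeriv_component {m : ℕ} (i j : Fin m) (α : ℝ → ℝ) (n : ℕ) (x : ℝ) :
    iteratedDeriv n (fun y => component i α y j) x = if j = i then iteratedDeriv n α x else 0 := by
  by_cases h : j = i <;> simp [component, h]

theorem deriv_component {m : ℕ} (i j : Fin m) (α : ℝ → ℝ) (x : ℝ) :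
    deriv (fun y => component i α y j) x = if j = i then deriv α x else 0 := by
  by_cases h : j = i <;> simp [component, h]

theorem pairing_component {m : ℕ} (i : Fin m) (α : ℝ → ℝ) (X : ℝ → Fin m → ℝ) :
    pairing (component i α) X = ∫ x, α x * X x i := by
  simp [pairing, component]

theorem constOp_component {m : ℕ} (A : Matrix (Fin m) (Fin m) ℝ) (n : ℕ) (u : ℝ → Fin m → ℝ)
    (j : Fin m) (γ : ℝ → ℝ) (x : ℝ) (l : Fin m) :
    constOp A n u (component j γ) x l = A l j * iteratedDeriv n γ x := by
  simp [constOp, iteratedDeriv_component]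

theorem pairing_lin_component {m : ℕ} {U : Set (Fin m → ℝ)} (hU : IsOpen U)
    {g : (Fin m → ℝ) → Matrix (Fin m) (Fin m) ℝ} {Γ : (Fin m → ℝ) → Fin m → Fin m → Fin m → ℝ}
    (hg : ∀ i j, ContDiffOn ℝ ∞ (fun u => g u i j) U)
    (hΓ : ∀ i j k, ContDiffOn ℝ ∞ (fun u => Γ u i j k) U) (A : Matrix (Fin m) (Fin m) ℝ) (n : ℕ)
    {u : ℝ → Fin m → ℝ} (hu : IsField U u) (i j l : Fin m) (α β : ℝ → ℝ) {γ : ℝ → ℝ}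
    (hγ : ContDiff ℝ ∞ γ) :
    pairing (component i α) ((hydroOp g Γ).lin u (constOp A n u (component l γ)) (component j β))
      = ∫ x, α x * ((∑ k, partialD k (fun w => g w i j) (u x) * A k l) * iteratedDeriv n γ x
          * deriv β x
        + ((∑ k, (∑ s, partialD s (fun w => Γ w i j k) (u x) * A s l)
              * deriv (fun y => u y k) x) * iteratedDeriv n γ x
          + (∑ k, Γ (u x) i j k * A k l) * iteratedDeriv (n + 1) γ x) * β x) := by
  rw [pairing_component]
  congr 1
  funext x
  rw [lin_hydroOp hU hg hΓ hu (contDiff_constOp A n u (contDiff_component l hγ))]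
  have hd : ∀ k, deriv (fun y => constOp A n u (component l γ) y k) x =
      A k l * iteratedDeriv (n + 1) γ x := fun k => by
    simp only [constOp_component, deriv_const_mul_field, iteratedDeriv_succ]
  simp only [hd, deriv_component]
  simp only [constOp_component, component, mul_ite, mul_zero]
  rw [Finset.sum_eq_single j (fun b _ hb => by simp [hb]) (by simp)]
  simp only [if_true, Finset.sum_mul, Finset.sum_add_distrib, ← mul_assoc]
  congr 4
  refine Finset.sum_congr rfl fun k _ => Finset.sum_congr rfl fun s _ => ?_
  ring

/-- The cyclic sum evaluated on single-component arguments along a constant field. -/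
theorem schouten_component_const {m : ℕ} {U : Set (Fin m → ℝ)} (hU : IsOpen U)
    {g : (Fin m → ℝ) → Matrix (Fin m) (Fin m) ℝ} {Γ : (Fin m → ℝ) → Fin m → Fin m → Fin m → ℝ}
    (hg : ∀ i j, ContDiffOn ℝ ∞ (fun u => g u i j) U)
    (hΓ : ∀ i j k, ContDiffOn ℝ ∞ (fun u => Γ u i j k) U) (A : Matrix (Fin m) (Fin m) ℝ) (n : ℕ)
    {w : Fin m → ℝ} (hw : w ∈ U) (i j l : Fin m) {α β γ : ℝ → ℝ}
    (hα : ContDiff ℝ ∞ α) (hβ : ContDiff ℝ ∞ β) (hγ : ContDiff ℝ ∞ γ)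
    {D E : Fin m → Fin m → Fin m → ℝ}
    (hD : ∀ i j l, D i j l = ∑ k, partialD k (fun w => g w i j) w * A k l)
    (hE : ∀ i j l, E i j l = ∑ k, Γ w i j k * A k l) :
    schouten (hydroOp g Γ) (constOp A n) (fun _ => w) (component i α) (component j β)
        (component l γ) =
      (∫ x, α x * (D i j l * iteratedDeriv n γ x * deriv β x
          + E i j l * iteratedDeriv (n + 1) γ x * β x))
        + (∫ x, β x * (D j l i * iteratedDeriv n α x * deriv γ x
          + E j l i * iteratedDeriv (n + 1) α x * γ x))
        + ∫ x, γ x * (D l i j * iteratedDeriv n β x * deriv α x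
          + E l i j * iteratedDeriv (n + 1) β x * α x) := by
  have hu : IsField U (fun _ : ℝ => w) := ⟨contDiff_const, fun _ => hw⟩
  unfold schouten
  rw [pairing_lin_component hU hg hΓ A n hu i j l α β hγ,
    pairing_lin_component hU hg hΓ A n hu j l i β γ hα,
    pairing_lin_component hU hg hΓ A n hu l i j γ α hβ]
  simp only [deriv_const, mul_zero, Finset.sum_const_zero, zero_mul, zero_add, ← hD, ← hE]

theorem hydroOp_const {m : ℕ} (g : (Fin m → ℝ) → Matrix (Fin m) (Fin m) ℝ)
    (Γ : (Fin m → ℝ) → Fin m → Fin m → Fin m → ℝ) (w : Fin m → ℝ) :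
    hydroOp g Γ (fun _ => w) = constOp (g w) 1 (fun _ => w) := by
  funext ξ x i
  simp [hydroOp, constOp]

theorem symm_of_skew {m : ℕ} {U : Set (Fin m → ℝ)}
    {g : (Fin m → ℝ) → Matrix (Fin m) (Fin m) ℝ} {Γ : (Fin m → ℝ) → Fin m → Fin m → Fin m → ℝ}
    (h : IsHamiltonian U (hydroOp g Γ)) {w : Fin m → ℝ} (hw : w ∈ U) (i j : Fin m) :
    g w i j = g w j i := by
  obtain ⟨φ, hφ, hc, h0⟩ := exists_integral_ne_zero
  have hu : IsField U (fun _ : ℝ => w) := ⟨contDiff_const, fun _ => hw⟩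
  have key := skew_of_smooth (isLocal_hydroOp g Γ) (fun ξ η => h.skew _ ξ η hu)
    (contDiff_component j contDiff_id) (isTest_component i hφ hc)
  simp only [hydroOp_const, pairing_component, constOp_component, iteratedDeriv_one] at key
  have h1 := integral_pow_mul_iteratedDeriv hφ hc 1
  simp only [pow_one, iteratedDeriv_one] at h1
  have e1 : ∀ x, φ x * (g w i j * deriv id x) = g w i j * φ x := fun x => by simp; ring
  have e2 : ∀ x, id x * (g w j i * deriv φ x) = g w j i * (x * deriv φ x) := fun x => by
    simp; ring
  simp only [e1, e2, integral_const_mul, h1] at key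
  refine mul_right_cancel₀ h0 ?_
  simpa using key

/-- The mixed condition along constant fields, read off from the third-order symbol:
the Christoffel-type coefficients are determined by `g`, and the derivatives of `g`, with their
last index raised by `A`, are invariant under cyclic permutations. -/
theorem third_order_conditions {m : ℕ} {U : Set (Fin m → ℝ)} (hU : IsOpen U)
    {g : (Fin m → ℝ) → Matrix (Fin m) (Fin m) ℝ} {Γ : (Fin m → ℝ) → Fin m → Fin m → Fin m → ℝ}
    (hg : ∀ i j, ContDiffOn ℝ ∞ (fun u => g u i j) U)
    (hΓ : ∀ i j k, ContDiffOn ℝ ∞ (fun u => Γ u i j k) U) {A : Matrix (Fin m) (Fin m) ℝ}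
    (h : AreCompatible U (hydroOp g Γ) (constOp A 3)) {w : Fin m → ℝ} (hw : w ∈ U)
    {D E : Fin m → Fin m → Fin m → ℝ}
    (hD : ∀ i j l, D i j l = ∑ k, partialD k (fun w => g w i j) w * A k l)
    (hE : ∀ i j l, E i j l = ∑ k, Γ w i j k * A k l) (i j l : Fin m) :
    E i j l = 1 / 2 * D i j l ∧ D l i j = D i j l := by
  obtain ⟨φ, hφ, hc, h0⟩ := exists_integral_ne_zero
  have hu : IsField U (fun _ : ℝ => w) := ⟨contDiff_const, fun _ => hw⟩
  have key : ∀ p q : ℕ, _ := fun p q =>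
    (schouten_of_areCompatible hU hg hΓ h hu (contDiff_component i (contDiff_monomial p))
      (contDiff_component j (contDiff_monomial q)) (isTest_component l hφ hc)).2
  simp only [schouten_component_const hU hg hΓ A 3 hw i j l (contDiff_monomial _)
    (contDiff_monomial _) hφ hD hE] at key
  have m3 := integral_pow_mul_iteratedDeriv hφ hc 3
  have m4 := integral_pow_mul_iteratedDeriv hφ hc 4
  have i3 : Integrable fun x => x ^ 3 * iteratedDeriv 3 φ x :=
    integrable_mul_of_compact (continuous_pow 3) (contDiff_iteratedDeriv hφ 3).continuous
      (hasCompactSupport_iteratedDeriv hc 3)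
  have i4 : Integrable fun x => x ^ 4 * iteratedDeriv 4 φ x :=
    integrable_mul_of_compact (continuous_pow 4) (contDiff_iteratedDeriv hφ 4).continuous
      (hasCompactSupport_iteratedDeriv hc 4)
  have hfirst : ∀ a b : ℝ, ∫ x, (a * (x ^ 3 * iteratedDeriv 3 φ x)
      + b * (x ^ 4 * iteratedDeriv 4 φ x)) = (24 * b - 6 * a) * ∫ x, φ x := fun a b => by
    rw [integral_add (i3.const_mul a) (i4.const_mul b), integral_const_mul, integral_const_mul,
      m3, m4]
    norm_num [Nat.factorial]
    ring
  have hpow : ∀ n p : ℕ, iteratedDeriv n (fun y : ℝ => y ^ p) =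
      fun x => (p.descFactorial n : ℝ) * x ^ (p - n) := fun n p => by funext x; simp
  -- For `x²`, `x²` only `D i j l` and `E i j l` contribute, for `x`, `x³` also `D l i j` does.
  have k22 := key 2 2
  have k13 := key 1 3
  have hE' : E i j l = 1 / 2 * D i j l := by
    have e1 : ∀ x : ℝ, x ^ 2 * (D i j l * iteratedDeriv 3 φ x * deriv (fun y => y ^ 2) x
        + E i j l * iteratedDeriv (3 + 1) φ x * x ^ 2) =
        2 * D i j l * (x ^ 3 * iteratedDeriv 3 φ x)
          + E i j l * (x ^ 4 * iteratedDeriv 4 φ x) := fun x => by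
      rw [← iteratedDeriv_one, hpow]
      simp
      ring
    simp only [e1, hfirst] at k22
    simp [Nat.descFactorial] at k22
    linarith [k22.resolve_right h0]
  refine ⟨hE', mul_right_cancel₀ h0 ?_⟩
  have e1 : ∀ x : ℝ, x ^ 1 * (D i j l * iteratedDeriv 3 φ x * deriv (fun y => y ^ 3) x
      + E i j l * iteratedDeriv (3 + 1) φ x * x ^ 3) =
      3 * D i j l * (x ^ 3 * iteratedDeriv 3 φ x)
        + E i j l * (x ^ 4 * iteratedDeriv 4 φ x) := fun x => by
    rw [← iteratedDeriv_one, hpow]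
    simp
    ring
  have e2 : ∀ x : ℝ, x ^ 3 * (D j l i * iteratedDeriv 3 (fun y => y ^ 1) x * deriv φ x
      + E j l i * iteratedDeriv (3 + 1) (fun y => y ^ 1) x * φ x) = 0 := fun x => by
    rw [hpow, hpow]
    simp [Nat.descFactorial]
  have e3 : ∀ x : ℝ, φ x * (D l i j * iteratedDeriv 3 (fun y => y ^ 3) x * deriv (fun y => y ^ 1) x
      + E l i j * iteratedDeriv (3 + 1) (fun y => y ^ 3) x * x ^ 1) =
      6 * D l i j * φ x := fun x => by
    rw [← iteratedDeriv_one, hpow, hpow, hpow]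
    simp [Nat.descFactorial]
    ring
  simp only [e1, e2, e3, hfirst, integral_const_mul, integral_zero] at k13
  rw [hE'] at k13
  linarith

/-- The Jacobi identity along constant fields: the tensor `∂_k g^{ij} g^{kl}` is invariant under
cyclic permutations. -/
theorem first_order_condition {m : ℕ} {U : Set (Fin m → ℝ)} (hU : IsOpen U)
    {g : (Fin m → ℝ) → Matrix (Fin m) (Fin m) ℝ} {Γ : (Fin m → ℝ) → Fin m → Fin m → Fin m → ℝ}
    (hg : ∀ i j, ContDiffOn ℝ ∞ (fun u => g u i j) U)
    (hΓ : ∀ i j k, ContDiffOn ℝ ∞ (fun u => Γ u i j k) U) {A : Matrix (Fin m) (Fin m) ℝ}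
    (h : AreCompatible U (hydroOp g Γ) (constOp A 3)) {w : Fin m → ℝ} (hw : w ∈ U)
    (hΓg : ∀ i j k, Γ w i j k = 1 / 2 * partialD k (fun w => g w i j) w)
    {T : Fin m → Fin m → Fin m → ℝ}
    (hT : ∀ i j l, T i j l = ∑ k, partialD k (fun w => g w i j) w * g w k l) (i j l : Fin m) :
    T l i j = T i j l := by
  obtain ⟨φ, hφ, hc, h0⟩ := exists_integral_ne_zero
  have hu : IsField U (fun _ : ℝ => w) := ⟨contDiff_const, fun _ => hw⟩
  have hE : ∀ i j l, 1 / 2 * T i j l = ∑ k, Γ w i j k * g w k l := fun i j l => by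
    simp only [hΓg, hT, Finset.mul_sum, mul_assoc]
  -- Testing with the functions `1` and `x²` singles out `T i j l` and `T l i j`.
  have key := (schouten_of_areCompatible hU hg hΓ h hu
      (contDiff_component i (contDiff_monomial 0))
      (contDiff_component j (contDiff_monomial 2)) (isTest_component l hφ hc)).1
  -- Along a constant field the first-order operator has constant coefficients.
  have hPQ : schouten (hydroOp g Γ) (hydroOp g Γ) (fun _ => w) =
      schouten (hydroOp g Γ) (constOp (g w) 1) (fun _ => w) := by
    unfold schouten
    rw [hydroOp_const]
  rw [hPQ, schouten_component_const hU hg hΓ (g w) 1 hw i j l (contDiff_monomial _)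
    (contDiff_monomial _) hφ hT hE] at key
  have m1 := integral_pow_mul_iteratedDeriv hφ hc 1
  have m2 := integral_pow_mul_iteratedDeriv hφ hc 2
  have i1 : Integrable fun x => x ^ 1 * iteratedDeriv 1 φ x :=
    integrable_mul_of_compact (continuous_pow 1) (contDiff_iteratedDeriv hφ 1).continuous
      (hasCompactSupport_iteratedDeriv hc 1)
  have i2 : Integrable fun x => x ^ 2 * iteratedDeriv 2 φ x :=
    integrable_mul_of_compact (continuous_pow 2) (contDiff_iteratedDeriv hφ 2).continuous
      (hasCompactSupport_iteratedDeriv hc 2)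
  have hpow : ∀ n p : ℕ, iteratedDeriv n (fun y : ℝ => y ^ p) =
      fun x => (p.descFactorial n : ℝ) * x ^ (p - n) := fun n p => by funext x; simp
  have e1 : ∀ x : ℝ, x ^ 0 * (T i j l * iteratedDeriv 1 φ x * deriv (fun y => y ^ 2) x
      + 1 / 2 * T i j l * iteratedDeriv (1 + 1) φ x * x ^ 2) =
      2 * T i j l * (x ^ 1 * iteratedDeriv 1 φ x)
        + 1 / 2 * T i j l * (x ^ 2 * iteratedDeriv 2 φ x) := fun x => by
    rw [← iteratedDeriv_one (f := fun y : ℝ => y ^ 2), hpow]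
    simp
    ring
  have e2 : ∀ x : ℝ, x ^ 2 * (T j l i * iteratedDeriv 1 (fun y => y ^ 0) x * deriv φ x
      + 1 / 2 * T j l i * iteratedDeriv (1 + 1) (fun y => y ^ 0) x * φ x) = 0 := fun x => by
    rw [hpow, hpow]
    simp
  have e3 : ∀ x : ℝ, φ x * (T l i j * iteratedDeriv 1 (fun y => y ^ 2) x * deriv (fun y => y ^ 0) x
      + 1 / 2 * T l i j * iteratedDeriv (1 + 1) (fun y => y ^ 2) x * x ^ 0) =
      T l i j * φ x := fun x => by
    rw [← iteratedDeriv_one (f := fun y : ℝ => y ^ 0), hpow, hpow, hpow]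
    simp [Nat.descFactorial]
    ring
  simp only [e1, e2, e3] at key
  rw [integral_add (i1.const_mul _) (i2.const_mul _), integral_const_mul, integral_const_mul,
    integral_const_mul, m1, m2] at key
  norm_num [Nat.factorial] at key
  refine mul_right_cancel₀ h0 ?_
  linarith

/-! ### Constancy of the first derivatives of the metric -/

/-- A smooth function whose third derivative vanishes weakly and which is constant near some point
is constant. -/
theorem const_of_integral_mul_iteratedDeriv_three {b : ℝ → ℝ} (hb : ContDiff ℝ ∞ b)
    (h : ∀ φ : ℝ → ℝ, ContDiff ℝ ∞ φ → HasCompactSupport φ →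
      ∫ x, b x * iteratedDeriv 3 φ x = 0) {y c : ℝ} (hy : b =ᶠ[𝓝 y] fun _ => c) (x : ℝ) :
    b x = c := by
  have h3 : iteratedDeriv 3 b = 0 := by
    have hae : ∀ᵐ x, iteratedDeriv 3 b x = 0 := by
      refine ae_eq_zero_of_integral_contDiff_smul_eq_zero
        (contDiff_iteratedDeriv hb 3).continuous.locallyIntegrable fun φ hφ hc => ?_
      have ibp : ∀ k n, ∫ x, iteratedDeriv k b x * iteratedDeriv (n + 1) φ x =
          -∫ x, iteratedDeriv (k + 1) b x * iteratedDeriv n φ x := fun k n => by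
        rw [iteratedDeriv_succ, iteratedDeriv_succ]
        exact integral_mul_deriv_of_compact (contDiff_iteratedDeriv hb k)
          (contDiff_iteratedDeriv hφ n) (hasCompactSupport_iteratedDeriv hc n)
      have h0 := h φ hφ hc
      rw [← iteratedDeriv_zero (f := b), ibp 0 2, ibp 1 1, ibp 2 0, iteratedDeriv_zero] at h0
      simpa [mul_comm] using h0
    exact (Continuous.ae_eq_iff_eq volume (contDiff_iteratedDeriv hb 3).continuous
      continuous_zero).1 hae
  -- A function with zero derivative which vanishes near `y` vanishes, so one can integrate thrice.
  have step : ∀ {f : ℝ → ℝ} {d : ℝ}, ContDiff ℝ ∞ f → deriv f = 0 → f y = d → f = fun _ => d :=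
    fun {f d} hf hf0 hfy => by
      funext z
      rw [← hfy]
      exact is_const_of_deriv_eq_zero (hf.differentiable (by simp)) (fun x => congrFun hf0 x) z y
  have hyn : ∀ n, iteratedDeriv n b y = iteratedDeriv n (fun _ => c) y := fun n =>
    hy.iteratedDeriv_eq n
  have h2 : iteratedDeriv 2 b = 0 :=
    step (d := 0) (contDiff_iteratedDeriv hb 2) (by rw [← iteratedDeriv_succ]; exact h3)
      (by rw [hyn]; simp [iteratedDeriv_const])
  have h1 : iteratedDeriv 1 b = 0 :=
    step (d := 0) (contDiff_iteratedDeriv hb 1) (by rw [← iteratedDeriv_succ]; exact h2)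
      (by rw [hyn]; simp [iteratedDeriv_const])
  exact congrFun (step hb (by rw [← iteratedDeriv_one]; exact h1) hy.eq_of_nhds) x

/-- Second partial derivatives commute. -/
theorem partialD_comm {m : ℕ} {U : Set (Fin m → ℝ)} (hU : IsOpen U) {f : (Fin m → ℝ) → ℝ}
    (hf : ContDiffOn ℝ ∞ f U) {w : Fin m → ℝ} (hw : w ∈ U) (k s : Fin m) :
    partialD s (partialD k f) w = partialD k (partialD s f) w := by
  have hfw : ContDiffAt ℝ ∞ f w := hf.contDiffAt (hU.mem_nhds hw)
  have hd : DifferentiableAt ℝ (fderiv ℝ f) w :=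
    (hfw.fderiv_right (m := 1) (by norm_cast)).differentiableAt (by simp)
  have h2 : ∀ k s, partialD s (partialD k f) w =
      fderiv ℝ (fderiv ℝ f) w (Pi.single s 1) (Pi.single k 1) := fun k s => by
    change fderiv ℝ (fun v => fderiv ℝ f v (Pi.single k 1)) w (Pi.single s 1) = _
    rw [fderiv_clm_apply hd (differentiableAt_const _)]
    simp
  rw [h2, h2]
  exact hfw.isSymmSndFDerivAt
    (by rw [minSmoothness_of_isRCLikeNormedField]; exact WithTop.coe_le_coe.2 le_top) _ _

/-- The mixed condition along arbitrary fields, tested against an affine function. -/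
theorem integral_partialD_mul_iteratedDeriv_three {m : ℕ} {U : Set (Fin m → ℝ)} (hU : IsOpen U)
    {g : (Fin m → ℝ) → Matrix (Fin m) (Fin m) ℝ} {Γ : (Fin m → ℝ) → Fin m → Fin m → Fin m → ℝ}
    (hg : ∀ i j, ContDiffOn ℝ ∞ (fun u => g u i j) U)
    (hΓ : ∀ i j k, ContDiffOn ℝ ∞ (fun u => Γ u i j k) U) {A : Matrix (Fin m) (Fin m) ℝ}
    (h : AreCompatible U (hydroOp g Γ) (constOp A 3))
    (hΓg : ∀ w ∈ U, ∀ i j k, Γ w i j k = 1 / 2 * partialD k (fun w => g w i j) w)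
    {u : ℝ → Fin m → ℝ} (hu : IsField U u) (i j l : Fin m) {φ : ℝ → ℝ} (hφ : ContDiff ℝ ∞ φ)
    (hc : HasCompactSupport φ) :
    ∫ x, (∑ k, partialD k (fun w => g w i j) (u x) * A k l) * iteratedDeriv 3 φ x = 0 := by
  have key := (schouten_of_areCompatible hU hg hΓ h hu
      (contDiff_component i (α := fun _ => 1) contDiff_const)
      (contDiff_component j contDiff_id) (isTest_component l hφ hc)).2
  unfold schouten at key
  rw [pairing_lin_component hU hg hΓ A 3 hu i j l _ _ hφ,
    pairing_lin_component hU hg hΓ A 3 hu j l i _ _ contDiff_const,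
    pairing_lin_component hU hg hΓ A 3 hu l i j _ _ contDiff_id] at key
  set b : ℝ → ℝ := fun x => ∑ k, partialD k (fun w => g w i j) (u x) * A k l with hb
  have hbs : ContDiff ℝ ∞ b := ContDiff.sum fun k _ =>
    (contDiff_comp_field hu (contDiffOn_partialD hU (hg i j) k)).mul contDiff_const
  have hE : ∀ x, ∑ k, Γ (u x) i j k * A k l = 1 / 2 * b x := fun x => by
    simp only [hb, hΓg _ (hu.mem x), Finset.mul_sum, mul_assoc]
  have hE' : ∀ x, ∑ k, (∑ s, partialD s (fun w => Γ w i j k) (u x) * A s l)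
      * deriv (fun y => u y k) x = 1 / 2 * deriv b x := fun x => by
    have h1 : deriv b x = ∑ s, (∑ k, partialD k (partialD s fun w => g w i j) (u x)
        * deriv (fun y => u y k) x) * A s l := by
      simp only [hb]
      rw [deriv_fun_sum fun s _ => ((contDiff_comp_field hu (contDiffOn_partialD hU (hg i j)
        s)).mul contDiff_const).differentiable (by simp) x]
      refine Finset.sum_congr rfl fun s _ => ?_
      rw [deriv_mul_const_field, deriv_comp_field hU hu (contDiffOn_partialD hU (hg i j) s)]
    have h2 : ∀ k s, partialD s (fun w => Γ w i j k) (u x) =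
        1 / 2 * partialD k (partialD s fun w => g w i j) (u x) := fun k s => by
      have he : (fun w => Γ w i j k) =ᶠ[𝓝 (u x)]
          fun w => (1 / 2 : ℝ) * partialD k (fun w => g w i j) w := by
        filter_upwards [hU.mem_nhds (hu.mem x)] with w hw using hΓg w hw i j k
      rw [partialD_comm hU (hg i j) (hu.mem x) s k]
      change fderiv ℝ (fun w => Γ w i j k) (u x) _ = _
      rw [he.fderiv_eq, fderiv_const_mul (differentiableAt_of_contDiffOn hU
        (contDiffOn_partialD hU (hg i j) k) (hu.mem x))]
      rfl
    simp only [h1, h2, Finset.sum_mul, Finset.mul_sum]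
    rw [Finset.sum_comm]
    refine Finset.sum_congr rfl fun s _ => Finset.sum_congr rfl fun k _ => ?_
    ring
  have hid3 : iteratedDeriv 3 (id : ℝ → ℝ) = 0 := by
    funext x
    simp [iteratedDeriv_succ]
  have hψ : ContDiff ℝ ∞ fun x => b x * iteratedDeriv 3 φ x :=
    hbs.mul (contDiff_iteratedDeriv hφ 3)
  have hψc : HasCompactSupport fun x => b x * iteratedDeriv 3 φ x :=
    (hasCompactSupport_iteratedDeriv hc 3).mul_left
  have hψ' : ∀ x, deriv (fun x => b x * iteratedDeriv 3 φ x) x =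
      deriv b x * iteratedDeriv 3 φ x + b x * iteratedDeriv (3 + 1) φ x := fun x => by
    rw [iteratedDeriv_succ (n := 3)]
    exact deriv_fun_mul (hbs.differentiable (by simp) x)
      ((contDiff_iteratedDeriv hφ 3).differentiable (by simp) x)
  -- For the arguments `1` and `x`, only the first summand survives, and its part containing `Γ` is
  -- `x / 2` times a total derivative.
  have e1 : ∀ x, (1 : ℝ) * (b x * iteratedDeriv 3 φ x * deriv id x
      + (1 / 2 * deriv b x * iteratedDeriv 3 φ x + 1 / 2 * b x * iteratedDeriv (3 + 1) φ x)
        * id x) = b x * iteratedDeriv 3 φ x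
        + 1 / 2 * (id x * deriv (fun x => b x * iteratedDeriv 3 φ x) x) := fun x => by
    rw [hψ']
    simp
    ring
  simp only [hE, hE'] at key
  have hIBP := integral_mul_deriv_of_compact contDiff_id hψ hψc
  have hi1 : Integrable fun x => b x * iteratedDeriv 3 φ x :=
    hψ.continuous.integrable_of_hasCompactSupport hψc
  have hi2 : Integrable fun x => id x * deriv (fun x => b x * iteratedDeriv 3 φ x) x :=
    integrable_mul_of_compact continuous_id (contDiff_deriv hψ).continuous hψc.deriv
  have hs1 : ∀ x, (∑ k, partialD k (fun w => g w i j) (u x) * A k l) = b x := fun x => rfl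
  simp only [hs1, e1] at key
  rw [integral_add hi1 (hi2.const_mul _), integral_const_mul, hIBP] at key
  simp [hid3, iteratedDeriv_succ (n := 3), iteratedDeriv_const] at key
  change ∫ x, b x * iteratedDeriv 3 φ x = 0
  linarith

theorem eq_of_eventually_const {m : ℕ} {U : Set (Fin m → ℝ)} (hU : IsOpen U)
    (hUc : IsConnected U) {B : (Fin m → ℝ) → ℝ} (hB : ContDiffOn ℝ ∞ B U)
    (h : ∀ w ∈ U, B =ᶠ[𝓝 w] fun _ => B w) {w w' : Fin m → ℝ} (hw : w ∈ U) (hw' : w' ∈ U) :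
    B w = B w' :=
  hU.is_const_of_fderiv_eq_zero hUc.isPreconnected (hB.differentiableOn (by simp))
    (fun v hv => by rw [(h v hv).fderiv_eq]; simp) hw hw'

/-- The derivatives of `g`, contracted with `A`, are constant: comparing a constant field with its
bump-like perturbations shows that they are locally constant. -/
theorem sum_partialD_eq {m : ℕ} {U : Set (Fin m → ℝ)} (hU : IsOpen U) (hUc : IsConnected U)
    {g : (Fin m → ℝ) → Matrix (Fin m) (Fin m) ℝ} {Γ : (Fin m → ℝ) → Fin m → Fin m → Fin m → ℝ}
    (hg : ∀ i j, ContDiffOn ℝ ∞ (fun u => g u i j) U)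
    (hΓ : ∀ i j k, ContDiffOn ℝ ∞ (fun u => Γ u i j k) U) {A : Matrix (Fin m) (Fin m) ℝ}
    (h : AreCompatible U (hydroOp g Γ) (constOp A 3))
    (hΓg : ∀ w ∈ U, ∀ i j k, Γ w i j k = 1 / 2 * partialD k (fun w => g w i j) w)
    (i j l : Fin m) {w w' : Fin m → ℝ} (hw : w ∈ U) (hw' : w' ∈ U) :
    ∑ k, partialD k (fun w => g w i j) w * A k l =
      ∑ k, partialD k (fun w => g w i j) w' * A k l := by
  set B : (Fin m → ℝ) → ℝ := fun w => ∑ k, partialD k (fun w => g w i j) w * A k l with hB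
  have hBs : ContDiffOn ℝ ∞ B U := ContDiffOn.sum fun k _ =>
    (contDiffOn_partialD hU (hg i j) k).mul contDiffOn_const
  refine eq_of_eventually_const hU hUc hBs (fun w hw => ?_) hw hw'
  obtain ⟨r, hr, hrU⟩ := Metric.isOpen_iff.1 hU w hw
  filter_upwards [Metric.ball_mem_nhds w hr] with v hv
  -- A field joining `w`, its value near `x = 5`, to `v`, its value at `x = 0`.
  let χ : ContDiffBump (0 : ℝ) := ⟨1, 2, by norm_num, by norm_num⟩
  have hu : IsField U (fun x : ℝ => w + χ x • (v - w)) := by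
    refine ⟨contDiff_const.add (χ.contDiff.smul contDiff_const), fun x => hrU ?_⟩
    exact (convex_ball w r).add_smul_sub_mem (Metric.mem_ball_self hr) hv ⟨χ.nonneg, χ.le_one⟩
  have hconst := const_of_integral_mul_iteratedDeriv_three (contDiff_comp_field hu hBs)
    (fun φ hφ hc => integral_partialD_mul_iteratedDeriv_three hU hg hΓ h hΓg hu i j l hφ hc)
    (y := 5) (c := B w) ?_ 0
  · have h1 : χ 0 = 1 := χ.one_of_mem_closedBall (by simp [χ])
    simpa [h1] using hconst
  · have h5 : (5 : ℝ) ∉ tsupport χ := by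
      rw [χ.tsupport_eq]
      simp [χ]
      norm_num
    filter_upwards [notMem_tsupport_iff_eventuallyEq.1 h5] with x hx
    simp [hx]

/-! ### Sufficient conditions for compatibility -/

theorem integral_eq_zero_of_hasDerivAt {F f : ℝ → ℝ} (hF : ContDiff ℝ ∞ F)
    (hc : HasCompactSupport F) (h : ∀ x, HasDerivAt F (f x) x) : ∫ x, f x = 0 := by
  have hf : f = deriv F := funext fun x => (h x).deriv.symm
  have hi := hF.continuous.integrable_of_hasCompactSupport hc (μ := volume)
  have hi' := (contDiff_deriv hF).continuous.integrable_of_hasCompactSupport hc.deriv (μ := volume)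
  rw [← hf] at hi'
  exact integral_eq_zero_of_hasDerivAt_of_integrable h hi' hi

/-- The `n`-th derivative of the `i`-th component of a covector field. -/
noncomputable def jet {m : ℕ} (n : ℕ) (ξ : ℝ → Fin m → ℝ) (x : ℝ) (i : Fin m) : ℝ :=
  iteratedDeriv n (fun y => ξ y i) x

theorem contDiff_jet {m : ℕ} (n : ℕ) {ξ : ℝ → Fin m → ℝ} (hξ : ContDiff ℝ ∞ ξ) (i : Fin m) :
    ContDiff ℝ ∞ fun x => jet n ξ x i :=
  contDiff_iteratedDeriv (contDiff_pi.1 hξ i) n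

theorem hasDerivAt_jet {m : ℕ} (n : ℕ) {ξ : ℝ → Fin m → ℝ} (hξ : ContDiff ℝ ∞ ξ) (i : Fin m)
    (x : ℝ) : HasDerivAt (fun x => jet n ξ x i) (jet (n + 1) ξ x i) x := by
  unfold jet
  rw [iteratedDeriv_succ]
  exact ((contDiff_jet n hξ i).differentiable (by simp) x).hasDerivAt

theorem jet_zero {m : ℕ} (ξ : ℝ → Fin m → ℝ) (x : ℝ) (i : Fin m) : jet 0 ξ x i = ξ x i := by
  simp [jet]

theorem deriv_eq_jet {m : ℕ} (ξ : ℝ → Fin m → ℝ) (x : ℝ) (i : Fin m) :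
    deriv (fun y => ξ y i) x = jet 1 ξ x i := by
  simp [jet]

theorem jet_eq_zero {m : ℕ} (n : ℕ) {ξ : ℝ → Fin m → ℝ} {x : ℝ} (hx : x ∉ tsupport ξ)
    (i : Fin m) : jet n ξ x i = 0 := by
  have h := eventuallyEq_apply (notMem_tsupport_iff_eventuallyEq.1 hx) i
  rw [jet, h.iteratedDeriv_eq]
  simp

section Sufficient

variable {m : ℕ} {U : Set (Fin m → ℝ)} {g : (Fin m → ℝ) → Matrix (Fin m) (Fin m) ℝ}
  {Γ : (Fin m → ℝ) → Fin m → Fin m → Fin m → ℝ} {A : Matrix (Fin m) (Fin m) ℝ}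
  {p : Fin m → Fin m → Fin m → ℝ}

theorem deriv_metric (hU : IsOpen U) (hg : ∀ i j, ContDiffOn ℝ ∞ (fun u => g u i j) U)
    (hp : ∀ w ∈ U, ∀ k i j, partialD k (fun w => g w i j) w = p k i j) {u : ℝ → Fin m → ℝ}
    (hu : IsField U u) (x : ℝ) (i j : Fin m) :
    deriv (fun y => g (u y) i j) x = ∑ k, p k i j * deriv (fun y => u y k) x := by
  rw [deriv_comp_field hU hu (hg i j)]
  simp only [hp _ (hu.mem x)]

theorem hasDerivAt_metric (hg : ∀ i j, ContDiffOn ℝ ∞ (fun u => g u i j) U) {u : ℝ → Fin m → ℝ}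
    (hu : IsField U u) (x : ℝ) (i j : Fin m) :
    HasDerivAt (fun y => g (u y) i j) (deriv (fun y => g (u y) i j) x) x :=
  ((contDiff_comp_field hu (hg i j)).differentiable (by simp) x).hasDerivAt

theorem combination_apply (hU : IsOpen U) (hg : ∀ i j, ContDiffOn ℝ ∞ (fun u => g u i j) U)
    (hp : ∀ w ∈ U, ∀ k i j, partialD k (fun w => g w i j) w = p k i j)
    (hΓp : ∀ w ∈ U, ∀ i j k, Γ w i j k = 1 / 2 * p k i j) (a b : ℝ) {u : ℝ → Fin m → ℝ}
    (hu : IsField U u) (ξ : ℝ → Fin m → ℝ) (x : ℝ) (i : Fin m) :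
    (a • hydroOp g Γ + b • constOp A 3) u ξ x i =
      ∑ j, (a * (g (u x) i j * jet 1 ξ x j + 1 / 2 * deriv (fun y => g (u y) i j) x * jet 0 ξ x j)
        + b * (A i j * jet 3 ξ x j)) := by
  have h : (a • hydroOp g Γ + b • constOp A 3) u ξ x i =
    a * hydroOp g Γ u ξ x i + b * constOp A 3 u ξ x i := rfl
  rw [h]
  simp only [hydroOp, constOp, Finset.mul_sum, ← Finset.sum_add_distrib, hΓp _ (hu.mem x),
    deriv_metric hU hg hp hu, jet_zero, deriv_eq_jet]
  refine Finset.sum_congr rfl fun j _ => ?_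
  simp only [mul_assoc]
  rfl

theorem contDiff_combination (hg : ∀ i j, ContDiffOn ℝ ∞ (fun u => g u i j) U)
    (hΓ : ∀ i j k, ContDiffOn ℝ ∞ (fun u => Γ u i j k) U) (a b : ℝ) {u ξ : ℝ → Fin m → ℝ}
    (hu : IsField U u) (hξ : ContDiff ℝ ∞ ξ) :
    ContDiff ℝ ∞ ((a • hydroOp g Γ + b • constOp A 3) u ξ) :=
  ((contDiff_hydroOp hg hΓ hu hξ).const_smul a).add ((contDiff_constOp A 3 u hξ).const_smul b)

/-- Skew-adjointness: the sum of the two integrands is a total derivative. -/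
theorem skew_combination (hU : IsOpen U) (hg : ∀ i j, ContDiffOn ℝ ∞ (fun u => g u i j) U)
    (hΓ : ∀ i j k, ContDiffOn ℝ ∞ (fun u => Γ u i j k) U)
    (hsymm : ∀ w ∈ U, ∀ i j, g w i j = g w j i) (hA : ∀ i j, A i j = A j i)
    (hp : ∀ w ∈ U, ∀ k i j, partialD k (fun w => g w i j) w = p k i j)
    (hΓp : ∀ w ∈ U, ∀ i j k, Γ w i j k = 1 / 2 * p k i j) (a b : ℝ) {u ξ η : ℝ → Fin m → ℝ}
    (hu : IsField U u) (hξ : IsTest ξ) (hη : IsTest η) :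
    pairing ξ ((a • hydroOp g Γ + b • constOp A 3) u η) =
      - pairing η ((a • hydroOp g Γ + b • constOp A 3) u ξ) := by
  rw [eq_neg_iff_add_eq_zero]
  unfold pairing
  rw [← integral_add (integrable_pairing hξ (contDiff_combination hg hΓ a b hu hη.smooth))
    (integrable_pairing hη (contDiff_combination hg hΓ a b hu hξ.smooth))]
  have hgs := fun i j => contDiff_comp_field hu (hg i j)
  refine integral_eq_zero_of_hasDerivAt (F := fun x => ∑ i, ∑ j,
    (a * (g (u x) i j * (jet 0 ξ x i * jet 0 η x j)) + b * (A i j * (jet 0 ξ x i * jet 2 η x j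
      - jet 1 ξ x i * jet 1 η x j + jet 2 ξ x i * jet 0 η x j)))) ?_ ?_ fun x => ?_
  · refine ContDiff.sum fun i _ => ContDiff.sum fun j _ => ?_
    have hx := fun n => contDiff_jet n hξ.smooth i
    have hy := fun n => contDiff_jet n hη.smooth j
    exact (contDiff_const.mul ((hgs i j).mul ((hx 0).mul (hy 0)))).add (contDiff_const.mul
      (contDiff_const.mul ((((hx 0).mul (hy 2)).sub ((hx 1).mul (hy 1))).add ((hx 2).mul (hy 0)))))
  · refine HasCompactSupport.intro hξ.compact fun x hx => ?_
    simp [jet_eq_zero _ hx]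
  · have hF := HasDerivAt.fun_sum (u := Finset.univ) fun (i : Fin m) _ =>
      HasDerivAt.fun_sum (u := Finset.univ) fun (j : Fin m) _ =>
        (((hasDerivAt_metric hg hu x i j).fun_mul ((hasDerivAt_jet 0 hξ.smooth i x).fun_mul
          (hasDerivAt_jet 0 hη.smooth j x))).const_mul a).fun_add
        ((((((hasDerivAt_jet 0 hξ.smooth i x).fun_mul (hasDerivAt_jet 2 hη.smooth j x)).fun_sub
          ((hasDerivAt_jet 1 hξ.smooth i x).fun_mul (hasDerivAt_jet 1 hη.smooth j x))).fun_add
          ((hasDerivAt_jet 2 hξ.smooth i x).fun_mul (hasDerivAt_jet 0 hη.smooth j x))).const_mul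
            (A i j)).const_mul b)
    refine hF.congr_deriv (Eq.symm ?_)
    simp only [combination_apply hU hg hp hΓp a b hu, jet_zero, Finset.mul_sum]
    rw [Finset.sum_comm (f := fun i j => η x i * _), ← Finset.sum_add_distrib]
    refine Finset.sum_congr rfl fun i _ => ?_
    rw [← Finset.sum_add_distrib]
    refine Finset.sum_congr rfl fun j _ => ?_
    have h1 : (fun y => g (u y) j i) = fun y => g (u y) i j :=
      funext fun y => hsymm _ (hu.mem y) j i
    rw [hA j i, hsymm _ (hu.mem x) j i, h1]
    ring

/-- The linearisation of an operator whose coefficients are affine in the field. -/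
theorem lin_combination (hU : IsOpen U) (hg : ∀ i j, ContDiffOn ℝ ∞ (fun u => g u i j) U)
    (hΓ : ∀ i j k, ContDiffOn ℝ ∞ (fun u => Γ u i j k) U)
    (hp : ∀ w ∈ U, ∀ k i j, partialD k (fun w => g w i j) w = p k i j)
    (hΓp : ∀ w ∈ U, ∀ i j k, Γ w i j k = 1 / 2 * p k i j) (a b : ℝ) {u v : ℝ → Fin m → ℝ}
    (hu : IsField U u) (hv : ContDiff ℝ ∞ v) (ξ : ℝ → Fin m → ℝ) (x : ℝ) (i : Fin m) :
    (a • hydroOp g Γ + b • constOp A 3).lin u v ξ x i =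
      ∑ j, ∑ l, a * p l i j * (jet 0 v x l * jet 1 ξ x j + 1 / 2 * jet 1 v x l * jet 0 ξ x j) := by
  have hΓ0 : ∀ i j k l, partialD l (fun w => Γ w i j k) (u x) = 0 := fun i j k l => by
    have he : (fun w => Γ w i j k) =ᶠ[𝓝 (u x)] fun _ => 1 / 2 * p k i j := by
      filter_upwards [hU.mem_nhds (hu.mem x)] with w hw using hΓp w hw i j k
    unfold partialD
    rw [he.fderiv_eq]
    simp
  rw [lin_smul_add_constOp]
  change a * (hydroOp g Γ).lin u v ξ x i = _
  rw [lin_hydroOp hU hg hΓ hu hv, Finset.mul_sum]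
  refine Finset.sum_congr rfl fun j _ => ?_
  simp only [hΓ0, hp _ (hu.mem x), hΓp _ (hu.mem x), zero_mul, Finset.sum_const_zero, zero_add,
    deriv_eq_jet, jet_zero, Finset.sum_mul, ← Finset.sum_add_distrib,
    Finset.mul_sum]
  refine Finset.sum_congr rfl fun l _ => ?_
  ring

/-- A primitive for the non-cyclic part of one summand of the Jacobi identity. Here `Y` stands for
the image of the third covector field, and the auxiliary `Z` is chosen so that `a / 2 * Y - Z'`
contains neither derivatives of the metric nor third derivatives. -/
noncomputable def primitive (a : ℝ) (p : Fin m → Fin m → Fin m → ℝ) (Y Z ξ η : ℝ → Fin m → ℝ)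
    (x : ℝ) : ℝ :=
  ∑ i, ∑ j, ∑ l, p l i j * (1 / 2 * a * (jet 0 Y x l * (jet 0 ξ x i * jet 0 η x j))
    + jet 0 Z x l * (jet 0 ξ x i * jet 1 η x j - jet 1 ξ x i * jet 0 η x j))

theorem contDiff_primitive (a : ℝ) (p : Fin m → Fin m → Fin m → ℝ) {Y Z ξ η : ℝ → Fin m → ℝ}
    (hY : ContDiff ℝ ∞ Y) (hZ : ContDiff ℝ ∞ Z) (hξ : ContDiff ℝ ∞ ξ) (hη : ContDiff ℝ ∞ η) :
    ContDiff ℝ ∞ (primitive a p Y Z ξ η) := by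
  refine ContDiff.sum fun i _ => ContDiff.sum fun j _ => ContDiff.sum fun l _ => ?_
  have hx := fun n => contDiff_jet n hξ i
  have hy := fun n => contDiff_jet n hη j
  exact contDiff_const.mul ((contDiff_const.mul ((contDiff_jet 0 hY l).mul
    ((hx 0).mul (hy 0)))).add ((contDiff_jet 0 hZ l).mul
      (((hx 0).mul (hy 1)).sub ((hx 1).mul (hy 0)))))

theorem hasCompactSupport_primitive (a : ℝ) (p : Fin m → Fin m → Fin m → ℝ)
    {Y Z ξ η : ℝ → Fin m → ℝ} (hξ : HasCompactSupport ξ) :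
    HasCompactSupport (primitive a p Y Z ξ η) := by
  refine HasCompactSupport.intro hξ fun x hx => ?_
  simp [primitive, jet_eq_zero _ hx]

theorem hasDerivAt_primitive (a : ℝ) (p : Fin m → Fin m → Fin m → ℝ) {Y Z ξ η : ℝ → Fin m → ℝ}
    (hY : ContDiff ℝ ∞ Y) (hZ : ContDiff ℝ ∞ Z) (hξ : ContDiff ℝ ∞ ξ) (hη : ContDiff ℝ ∞ η)
    (x : ℝ) :
    HasDerivAt (primitive a p Y Z ξ η)
      ((∑ i, ξ x i * ∑ j, ∑ l, a * p l i j *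
          (jet 0 Y x l * jet 1 η x j + 1 / 2 * jet 1 Y x l * jet 0 η x j))
        - ∑ i, ∑ j, ∑ l, p l i j * ((1 / 2 * a * jet 0 Y x l - jet 1 Z x l) *
            (jet 0 ξ x i * jet 1 η x j - jet 1 ξ x i * jet 0 η x j)
          - jet 0 Z x l * (jet 0 ξ x i * jet 2 η x j - jet 2 ξ x i * jet 0 η x j))) x := by
  have hx := fun n i => hasDerivAt_jet n hξ i x
  have hy := fun n j => hasDerivAt_jet n hη j x
  have hF := HasDerivAt.fun_sum (u := Finset.univ) fun (i : Fin m) _ =>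
    HasDerivAt.fun_sum (u := Finset.univ) fun (j : Fin m) _ =>
      HasDerivAt.fun_sum (u := Finset.univ) fun (l : Fin m) _ =>
        ((((hasDerivAt_jet 0 hY l x).fun_mul ((hx 0 i).fun_mul (hy 0 j))).const_mul
          (1 / 2 * a)).fun_add ((hasDerivAt_jet 0 hZ l x).fun_mul
            (((hx 0 i).fun_mul (hy 1 j)).fun_sub ((hx 1 i).fun_mul (hy 0 j))))).const_mul (p l i j)
  refine hF.congr_deriv (Eq.symm ?_)
  simp only [jet_zero, Finset.mul_sum, ← Finset.sum_sub_distrib]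
  refine Finset.sum_congr rfl fun i _ => Finset.sum_congr rfl fun j _ =>
    Finset.sum_congr rfl fun l _ => ?_
  ring

/-- A cyclically invariant tensor turns a cyclic sum into a sum of cyclic sums. -/
theorem sum_cyclic {T : Fin m → Fin m → Fin m → ℝ} (hT : ∀ i j l, T l i j = T i j l)
    (f₁ f₂ f₃ : Fin m → Fin m → Fin m → ℝ) (h : ∀ i j l, f₁ i j l + f₂ j l i + f₃ l i j = 0) :
    (∑ i, ∑ j, ∑ l, T i j l * f₁ i j l) + (∑ i, ∑ j, ∑ l, T i j l * f₂ i j l)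
      + ∑ i, ∑ j, ∑ l, T i j l * f₃ i j l = 0 := by
  have h2 : ∑ i, ∑ j, ∑ l, T i j l * f₂ i j l = ∑ i, ∑ j, ∑ l, T j l i * f₂ j l i := by
    rw [Finset.sum_comm_cycle]
  have h3 : ∑ i, ∑ j, ∑ l, T i j l * f₃ i j l = ∑ i, ∑ j, ∑ l, T l i j * f₃ l i j := by
    rw [← Finset.sum_comm_cycle]
  rw [h2, h3]
  simp only [← Finset.sum_add_distrib]
  refine Finset.sum_eq_zero fun i _ => Finset.sum_eq_zero fun j _ =>
    Finset.sum_eq_zero fun l _ => ?_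
  rw [hT i j l, ← hT j l i, ← mul_add, ← mul_add, h, mul_zero]

theorem contDiff_auxiliary (hg : ∀ i j, ContDiffOn ℝ ∞ (fun u => g u i j) U) (a b : ℝ)
    {u ζ : ℝ → Fin m → ℝ} (hu : IsField U u) (hζ : ContDiff ℝ ∞ ζ) :
    ContDiff ℝ ∞ fun x l => ∑ k, (1 / 4 * a ^ 2 * (g (u x) l k * jet 0 ζ x k)
      + 1 / 2 * a * b * (A l k * jet 2 ζ x k)) := by
  refine contDiff_pi.2 fun l => ContDiff.sum fun k _ => ?_
  exact (contDiff_const.mul ((contDiff_comp_field hu (hg l k)).mul (contDiff_jet 0 hζ k))).add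
    (contDiff_const.mul (contDiff_const.mul (contDiff_jet 2 hζ k)))

theorem jet_auxiliary (hg : ∀ i j, ContDiffOn ℝ ∞ (fun u => g u i j) U) (a b : ℝ)
    {u ζ : ℝ → Fin m → ℝ} (hu : IsField U u) (hζ : ContDiff ℝ ∞ ζ) (x : ℝ) (l : Fin m) :
    jet 1 (fun x l => ∑ k, (1 / 4 * a ^ 2 * (g (u x) l k * jet 0 ζ x k)
      + 1 / 2 * a * b * (A l k * jet 2 ζ x k))) x l =
      ∑ k, (1 / 4 * a ^ 2 * (deriv (fun y => g (u y) l k) x * jet 0 ζ x k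
        + g (u x) l k * jet 1 ζ x k) + 1 / 2 * a * b * (A l k * jet 3 ζ x k)) := by
  rw [← deriv_eq_jet]
  refine (HasDerivAt.fun_sum fun k _ => ?_).deriv
  exact (((hasDerivAt_metric hg hu x l k).fun_mul (hasDerivAt_jet 0 hζ k x)).const_mul _).fun_add
    (((hasDerivAt_jet 2 hζ k x).const_mul _).const_mul _)

/-- The non-exact part of one summand of the Jacobi identity, expressed by the two tensors
`∂_k g^{ij} g^{kl}` and `∂_k g^{ij} A^{kl}`. -/
theorem remainder_eq (hU : IsOpen U) (hg : ∀ i j, ContDiffOn ℝ ∞ (fun u => g u i j) U)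
    (hp : ∀ w ∈ U, ∀ k i j, partialD k (fun w => g w i j) w = p k i j)
    (hΓp : ∀ w ∈ U, ∀ i j k, Γ w i j k = 1 / 2 * p k i j) (a b : ℝ)
    {u Y Z ξ η ζ : ℝ → Fin m → ℝ} (hu : IsField U u) (hζ : ContDiff ℝ ∞ ζ)
    (hY : Y = (a • hydroOp g Γ + b • constOp A 3) u ζ)
    (hZ : Z = fun x l => ∑ k, (1 / 4 * a ^ 2 * (g (u x) l k * jet 0 ζ x k)
      + 1 / 2 * a * b * (A l k * jet 2 ζ x k))) (x : ℝ) :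
    ∑ i, ∑ j, ∑ l, p l i j * ((1 / 2 * a * jet 0 Y x l - jet 1 Z x l) *
            (jet 0 ξ x i * jet 1 η x j - jet 1 ξ x i * jet 0 η x j)
          - jet 0 Z x l * (jet 0 ξ x i * jet 2 η x j - jet 2 ξ x i * jet 0 η x j)) =
      1 / 4 * a ^ 2 * (∑ i, ∑ j, ∑ k, (∑ l, p l i j * g (u x) l k) *
        (jet 1 ζ x k * (jet 0 ξ x i * jet 1 η x j - jet 1 ξ x i * jet 0 η x j)
          - jet 0 ζ x k * (jet 0 ξ x i * jet 2 η x j - jet 2 ξ x i * jet 0 η x j)))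
      + 1 / 2 * a * b * ∑ i, ∑ j, ∑ k, (∑ l, p l i j * A l k) *
        (- jet 2 ζ x k * (jet 0 ξ x i * jet 2 η x j - jet 2 ξ x i * jet 0 η x j)) := by
  simp only [Finset.mul_sum, ← Finset.sum_add_distrib]
  refine Finset.sum_congr rfl fun i _ => Finset.sum_congr rfl fun j _ => ?_
  have h1 : ∀ l, 1 / 2 * a * jet 0 Y x l - jet 1 Z x l =
      ∑ k, 1 / 4 * a ^ 2 * (g (u x) l k * jet 1 ζ x k) := fun l => by
    rw [hY, hZ, jet_auxiliary hg a b hu hζ, jet_zero, combination_apply hU hg hp hΓp a b hu,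
      Finset.mul_sum, ← Finset.sum_sub_distrib]
    refine Finset.sum_congr rfl fun k _ => ?_
    ring
  simp only [h1]
  rw [hZ]
  simp only [jet_zero, Finset.sum_mul, ← Finset.sum_sub_distrib, ← Finset.sum_add_distrib,
    Finset.mul_sum]
  rw [Finset.sum_comm]
  refine Finset.sum_congr rfl fun k _ => Finset.sum_congr rfl fun l _ => ?_
  ring

/-- The Jacobi identity: the sum of the three integrands is a total derivative, because the
remaining terms cancel by the cyclic invariance of the two tensors. -/
theorem jacobi_combination (hU : IsOpen U) (hg : ∀ i j, ContDiffOn ℝ ∞ (fun u => g u i j) U)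
    (hΓ : ∀ i j k, ContDiffOn ℝ ∞ (fun u => Γ u i j k) U)
    (hp : ∀ w ∈ U, ∀ k i j, partialD k (fun w => g w i j) w = p k i j)
    (hΓp : ∀ w ∈ U, ∀ i j k, Γ w i j k = 1 / 2 * p k i j)
    (hcA : ∀ i j l, ∑ k, p k l i * A k j = ∑ k, p k i j * A k l)
    (hcg : ∀ w ∈ U, ∀ i j l, ∑ k, p k l i * g w k j = ∑ k, p k i j * g w k l)
    (a b : ℝ) {u ξ η ζ : ℝ → Fin m → ℝ} (hu : IsField U u) (hξ : IsTest ξ) (hη : IsTest η)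
    (hζ : IsTest ζ) :
    schouten (a • hydroOp g Γ + b • constOp A 3) (a • hydroOp g Γ + b • constOp A 3) u ξ η ζ
      = 0 := by
  have hYs := fun {ξ : ℝ → Fin m → ℝ} (hξ : IsTest ξ) =>
    contDiff_combination (A := A) hg hΓ a b hu hξ.smooth
  have hlin : ∀ {ξ η : ℝ → Fin m → ℝ}, IsTest ξ → IsTest η → ContDiff ℝ ∞
      ((a • hydroOp g Γ + b • constOp A 3).lin u
        ((a • hydroOp g Γ + b • constOp A 3) u ξ) η) := fun hξ hη => by
    rw [lin_smul_add_constOp]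
    exact (contDiff_lin_hydroOp hU hg hΓ hu (hYs hξ) hη.smooth).const_smul a
  set Y : (ℝ → Fin m → ℝ) → ℝ → Fin m → ℝ := (a • hydroOp g Γ + b • constOp A 3) u with hY
  set Z : (ℝ → Fin m → ℝ) → ℝ → Fin m → ℝ := fun ζ x l =>
    ∑ k, (1 / 4 * a ^ 2 * (g (u x) l k * jet 0 ζ x k)
      + 1 / 2 * a * b * (A l k * jet 2 ζ x k)) with hZ
  have hZs := fun {ξ : ℝ → Fin m → ℝ} (hξ : IsTest ξ) =>
    contDiff_auxiliary (A := A) hg a b hu hξ.smooth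
  unfold schouten pairing
  rw [← integral_add (integrable_pairing hξ (hlin hζ hη)) (integrable_pairing hη (hlin hξ hζ)),
    ← integral_add
      (by exact (integrable_pairing hξ (hlin hζ hη)).add (integrable_pairing hη (hlin hξ hζ)))
      (integrable_pairing hζ (hlin hη hξ))]
  have hcp : ∀ {ξ η ζ : ℝ → Fin m → ℝ}, IsTest ξ → IsTest η → IsTest ζ →
      ContDiff ℝ ∞ (primitive a p (Y ζ) (Z ζ) ξ η) := fun hξ hη hζ =>
    contDiff_primitive a p (hYs hζ) (hZs hζ) hξ.smooth hη.smooth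
  refine integral_eq_zero_of_hasDerivAt (F := fun x => primitive a p (Y ζ) (Z ζ) ξ η x
    + primitive a p (Y ξ) (Z ξ) η ζ x + primitive a p (Y η) (Z η) ζ ξ x)
    (((hcp hξ hη hζ).add (hcp hη hζ hξ)).add (hcp hζ hξ hη))
    (((hasCompactSupport_primitive a p hξ.compact).add
      (hasCompactSupport_primitive a p hη.compact)).add
      (hasCompactSupport_primitive a p hζ.compact)) fun x => ?_
  have hF := ((hasDerivAt_primitive a p (hYs hζ) (hZs hζ) hξ.smooth hη.smooth x).fun_add
    (hasDerivAt_primitive a p (hYs hξ) (hZs hξ) hη.smooth hζ.smooth x)).fun_add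
    (hasDerivAt_primitive a p (hYs hη) (hZs hη) hζ.smooth hξ.smooth x)
  refine hF.congr_deriv (Eq.symm ?_)
  rw [remainder_eq hU hg hp hΓp a b hu hζ.smooth rfl rfl,
    remainder_eq hU hg hp hΓp a b hu hξ.smooth rfl rfl,
    remainder_eq hU hg hp hΓp a b hu hη.smooth rfl rfl]
  have hTg := sum_cyclic (T := fun i j k => ∑ l, p l i j * g (u x) l k)
    (fun i j l => hcg _ (hu.mem x) i j l)
    (fun i j k => jet 1 ζ x k * (jet 0 ξ x i * jet 1 η x j - jet 1 ξ x i * jet 0 η x j)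
      - jet 0 ζ x k * (jet 0 ξ x i * jet 2 η x j - jet 2 ξ x i * jet 0 η x j))
    (fun i j k => jet 1 ξ x k * (jet 0 η x i * jet 1 ζ x j - jet 1 η x i * jet 0 ζ x j)
      - jet 0 ξ x k * (jet 0 η x i * jet 2 ζ x j - jet 2 η x i * jet 0 ζ x j))
    (fun i j k => jet 1 η x k * (jet 0 ζ x i * jet 1 ξ x j - jet 1 ζ x i * jet 0 ξ x j)
      - jet 0 η x k * (jet 0 ζ x i * jet 2 ξ x j - jet 2 ζ x i * jet 0 ξ x j))
    (fun i j l => by ring)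
  have hTA := sum_cyclic (T := fun i j k => ∑ l, p l i j * A l k)
    (fun i j l => hcA i j l)
    (fun i j k => - jet 2 ζ x k * (jet 0 ξ x i * jet 2 η x j - jet 2 ξ x i * jet 0 η x j))
    (fun i j k => - jet 2 ξ x k * (jet 0 η x i * jet 2 ζ x j - jet 2 η x i * jet 0 ζ x j))
    (fun i j k => - jet 2 η x k * (jet 0 ζ x i * jet 2 ξ x j - jet 2 ζ x i * jet 0 ξ x j))
    (fun i j l => by ring)
  simp only [lin_combination hU hg hΓ hp hΓp a b hu (hYs hζ),
    lin_combination hU hg hΓ hp hΓp a b hu (hYs hξ),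
    lin_combination hU hg hΓ hp hΓp a b hu (hYs hη)]
  linear_combination 1 / 4 * a ^ 2 * hTg + 1 / 2 * a * b * hTA

/-- Sufficient conditions for compatibility with a constant third-order operator. -/
theorem areCompatible_of_cyclic (hU : IsOpen U)
    (hg : ∀ i j, ContDiffOn ℝ ∞ (fun u => g u i j) U)
    (hΓ : ∀ i j k, ContDiffOn ℝ ∞ (fun u => Γ u i j k) U)
    (hsymm : ∀ w ∈ U, ∀ i j, g w i j = g w j i) (hA : ∀ i j, A i j = A j i)
    (hp : ∀ w ∈ U, ∀ k i j, partialD k (fun w => g w i j) w = p k i j)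
    (hΓp : ∀ w ∈ U, ∀ i j k, Γ w i j k = 1 / 2 * p k i j)
    (hcA : ∀ i j l, ∑ k, p k l i * A k j = ∑ k, p k i j * A k l)
    (hcg : ∀ w ∈ U, ∀ i j l, ∑ k, p k l i * g w k j = ∑ k, p k i j * g w k l) :
    AreCompatible U (hydroOp g Γ) (constOp A 3) := fun a b =>
  { skew := fun _ _ _ hu hξ hη =>
      skew_combination hU hg hΓ hsymm hA hp hΓp a b hu hξ hη
    jacobi := fun _ _ _ _ hu hξ hη hζ =>
      jacobi_combination hU hg hΓ hp hΓp hcA hcg a b hu hξ hη hζ }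

end Sufficient

/-! ### Contravariant Christoffel symbols -/

theorem differentiableAt_det {E n : Type*} [NormedAddCommGroup E] [NormedSpace ℝ E] [Fintype n]
    [DecidableEq n] {M : E → Matrix n n ℝ} {w : E}
    (hM : ∀ i j, DifferentiableAt ℝ (fun v => M v i j) w) :
    DifferentiableAt ℝ (fun v => (M v).det) w := by
  simp only [Matrix.det_apply']
  exact DifferentiableAt.fun_sum fun σ _ =>
    (HasFDerivAt.finsetProd fun i _ => (hM (σ i) i).hasFDerivAt).differentiableAt.const_mul _

theorem differentiableAt_inv_apply {E n : Type*} [NormedAddCommGroup E] [NormedSpace ℝ E]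
    [Fintype n] [DecidableEq n] {M : E → Matrix n n ℝ} {w : E}
    (hM : ∀ i j, DifferentiableAt ℝ (fun v => M v i j) w) (h0 : (M w).det ≠ 0) (i j : n) :
    DifferentiableAt ℝ (fun v => (M v)⁻¹ i j) w := by
  simp only [Matrix.inv_def, Ring.inverse_eq_inv', Matrix.smul_apply, smul_eq_mul,
    Matrix.adjugate_apply]
  refine ((differentiableAt_det hM).inv h0).mul (differentiableAt_det fun a b => ?_)
  by_cases h : a = j
  · subst h
    simp
  · simpa [Matrix.updateRow_apply, h] using hM a b

/-- For a metric with constant derivatives `p k i j = ∂_k g^{ij}` such that `∂_k g^{ij} g^{kl}` is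
cyclically invariant, the contravariant Christoffel symbols are half the derivatives. -/
theorem contraChristoffel_eq {m : ℕ} {U : Set (Fin m → ℝ)} (hU : IsOpen U)
    {g : (Fin m → ℝ) → Matrix (Fin m) (Fin m) ℝ} {p : Fin m → Fin m → Fin m → ℝ}
    (hg : ∀ i j, ContDiffOn ℝ ∞ (fun u => g u i j) U)
    (hdet : ∀ w ∈ U, (g w).det ≠ 0)
    (hsymm : ∀ w ∈ U, ∀ i j, g w i j = g w j i) (hps : ∀ k i j, p k i j = p k j i)
    (hp : ∀ w ∈ U, ∀ k i j, partialD k (fun w => g w i j) w = p k i j)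
    (hcg : ∀ w ∈ U, ∀ i j l, ∑ k, p k l i * g w k j = ∑ k, p k i j * g w k l)
    {w : Fin m → ℝ} (hw : w ∈ U) (i j k : Fin m) :
    contraChristoffel g w i j k = 1 / 2 * p k i j := by
  set H : Fin m → Fin m → Fin m → ℝ := fun l s k => partialD l (fun w => (g w)⁻¹ s k) w with hH
  have hgd : ∀ i j, DifferentiableAt ℝ (fun v => g v i j) w := fun i j =>
    differentiableAt_of_contDiffOn hU (hg i j) hw
  have hhd := differentiableAt_inv_apply hgd (hdet w hw)
  -- Differentiate `g * g⁻¹ = 1`.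
  have hgH : ∀ l j k, ∑ s, g w j s * H l s k = -∑ s, p l j s * (g w)⁻¹ s k := fun l j k => by
    have he : (fun v => ∑ s, g v j s * (g v)⁻¹ s k) =ᶠ[𝓝 w]
        fun _ => (1 : Matrix (Fin m) (Fin m) ℝ) j k := by
      filter_upwards [hU.mem_nhds hw] with v hv
      rw [← Matrix.mul_nonsing_inv (g v) (isUnit_iff_ne_zero.2 (hdet v hv)), Matrix.mul_apply]
    have hd : partialD l (fun v => ∑ s, g v j s * (g v)⁻¹ s k) w = 0 := by
      unfold partialD
      rw [he.fderiv_eq]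
      simp
    have hd' : partialD l (fun v => ∑ s, g v j s * (g v)⁻¹ s k) w =
        ∑ s, (g w j s * H l s k + (g w)⁻¹ s k * p l j s) := by
      unfold partialD
      rw [fderiv_fun_sum fun s _ => (hgd j s).fun_mul (hhd s k), sum_apply]
      refine Finset.sum_congr rfl fun s _ => ?_
      rw [fderiv_fun_mul (hgd j s) (hhd s k), ← hp w hw l j s]
      rfl
    rw [hd, Finset.sum_add_distrib] at hd'
    rw [eq_neg_iff_add_eq_zero, hd']
    simp only [mul_comm]
  have hinv : ∀ s i, ∑ l, (g w)⁻¹ s l * g w l i = (1 : Matrix (Fin m) (Fin m) ℝ) s i :=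
      fun s i => by
    rw [← Matrix.nonsing_inv_mul (g w) (isUnit_iff_ne_zero.2 (hdet w hw)), Matrix.mul_apply]
  -- The tensor `∂_k g^{ij} g^{kl}` is totally symmetric.
  have hT : ∀ i j b, ∑ l, g w i l * p l j b = ∑ l, p l i j * g w l b := fun i j b => by
    rw [hcg w hw j b i]
    exact Finset.sum_congr rfl fun l _ => by rw [hsymm w hw i l, mul_comm]
  have h1 : ∑ l, g w i l * ∑ s, g w j s * H l s k =
      -∑ b, (∑ l, p l i j * g w l b) * (g w)⁻¹ b k := by
    simp only [hgH, mul_neg, Finset.sum_neg_distrib, ← hT i j, Finset.mul_sum, Finset.sum_mul]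
    rw [Finset.sum_comm]
    simp only [mul_assoc]
  have h3 : ∑ l, g w i l * ∑ s, g w j s * H s l k =
      -∑ b, (∑ l, p l i j * g w l b) * (g w)⁻¹ b k := by
    have : ∑ l, g w i l * ∑ s, g w j s * H s l k = ∑ s, g w j s * ∑ l, g w i l * H s l k := by
      simp only [Finset.mul_sum]
      rw [Finset.sum_comm]
      refine Finset.sum_congr rfl fun s _ => Finset.sum_congr rfl fun l _ => by ring
    rw [this]
    simp only [hps _ i j, ← hT j i]
    simp only [hgH, mul_neg, Finset.sum_neg_distrib, Finset.mul_sum, Finset.sum_mul]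
    rw [Finset.sum_comm]
    simp only [mul_assoc]
  have h2 : ∑ l, g w i l * ∑ s, g w j s * H k s l = -p k i j := by
    simp only [hgH, mul_neg, Finset.sum_neg_distrib, Finset.mul_sum]
    rw [Finset.sum_comm]
    have : ∀ s, ∑ l, g w i l * (p k j s * (g w)⁻¹ s l) =
        p k j s * (1 : Matrix (Fin m) (Fin m) ℝ) s i := fun s => by
      rw [← hinv, Finset.mul_sum]
      refine Finset.sum_congr rfl fun l _ => ?_
      rw [hsymm w hw i l]
      ring
    simp [this, Matrix.one_apply, hps k j i]
  have hsplit : contraChristoffel g w i j k = -(1 / 2 * (∑ l, g w i l * ∑ s, g w j s * H l s k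
      + ∑ l, g w i l * ∑ s, g w j s * H k s l - ∑ l, g w i l * ∑ s, g w j s * H s l k)) := by
    simp only [contraChristoffel, christoffel, hH, Finset.mul_sum, ← Finset.sum_add_distrib,
      ← Finset.sum_sub_distrib]
    congr 1
    refine Finset.sum_congr rfl fun l _ => Finset.sum_congr rfl fun s _ => ?_
    ring
  rw [hsplit, h1, h2, h3]
  ring

/-! ### The planar case -/

theorem partialD_affine {U : Set (Fin 2 → ℝ)} (hU : IsOpen U) {f : (Fin 2 → ℝ) → ℝ} {a b c : ℝ}
    (hf : ∀ u ∈ U, f u = a * u 0 + b * u 1 + c) {w : Fin 2 → ℝ} (hw : w ∈ U) :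
    partialD 0 f w = a ∧ partialD 1 f w = b := by
  have he : f =ᶠ[𝓝 w] fun u => a * u 0 + b * u 1 + c := by
    filter_upwards [hU.mem_nhds hw] with u hu using hf u hu
  have hd : HasFDerivAt (fun u : Fin 2 → ℝ => a * u 0 + b * u 1 + c)
      (a • ContinuousLinearMap.proj (R := ℝ) (φ := fun _ : Fin 2 => ℝ) 0
        + b • ContinuousLinearMap.proj (R := ℝ) (φ := fun _ : Fin 2 => ℝ) 1) w :=
    (((hasFDerivAt_apply 0 w).const_mul a).add ((hasFDerivAt_apply 1 w).const_mul b)).add_const c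
  unfold partialD
  rw [he.fderiv_eq, hd.fderiv]
  simp

theorem exists_affine {U : Set (Fin 2 → ℝ)} (hU : IsOpen U) (hUc : IsConnected U)
    {f : (Fin 2 → ℝ) → ℝ} (hf : ContDiffOn ℝ ∞ f U) {a b : ℝ} (ha : ∀ u ∈ U, partialD 0 f u = a)
    (hb : ∀ u ∈ U, partialD 1 f u = b) : ∃ c, ∀ u ∈ U, f u = a * u 0 + b * u 1 + c := by
  have hl : ∀ w : Fin 2 → ℝ, HasFDerivAt (fun u : Fin 2 → ℝ => a * u 0 + b * u 1)
      (a • ContinuousLinearMap.proj (R := ℝ) (φ := fun _ : Fin 2 => ℝ) 0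
        + b • ContinuousLinearMap.proj (R := ℝ) (φ := fun _ : Fin 2 => ℝ) 1) w := fun w =>
    ((hasFDerivAt_apply 0 w).const_mul a).add ((hasFDerivAt_apply 1 w).const_mul b)
  obtain ⟨c, hc⟩ := hU.exists_is_const_of_fderiv_eq_zero hUc.isPreconnected
    (f := fun u => f u - (a * u 0 + b * u 1))
    ((hf.differentiableOn (by simp)).sub fun w _ => (hl w).differentiableAt.differentiableWithinAt)
    fun w hw => by
      rw [fderiv_fun_sub (differentiableAt_of_contDiffOn hU hf hw) (hl w).differentiableAt,
        (hl w).fderiv]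
      ext v
      simp [fderiv_eq_sum_partialD, ha w hw, hb w hw]
  exact ⟨c, fun u hu => by linarith [hc u hu]⟩

theorem affine_eq_zero {U : Set (Fin 2 → ℝ)} (hU : IsOpen U) (hUn : U.Nonempty) {a b c : ℝ}
    (h : ∀ u ∈ U, a * u 0 + b * u 1 + c = 0) : a = 0 ∧ b = 0 ∧ c = 0 := by
  obtain ⟨w, hw⟩ := hUn
  obtain ⟨h0, h1⟩ := partialD_affine hU (f := fun _ => 0) (fun u hu => (h u hu).symm) hw
  have ha : a = 0 := by rw [← h0]; simp [partialD]
  have hb : b = 0 := by rw [← h1]; simp [partialD]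
  have := h w hw
  simp only [ha, hb] at this
  exact ⟨ha, hb, by linarith⟩

/-- The seven-parameter family of affine contravariant metrics, with its quadratic constraints. -/
def IsSevenParameter (U : Set (Fin 2 → ℝ)) (g : (Fin 2 → ℝ) → Matrix (Fin 2) (Fin 2) ℝ) : Prop :=
  ∃ c₁ c₂ c₃ c₄ c₅ c₆ c₇ : ℝ,
    (∀ u ∈ U,
      g u 0 0 = c₁ * u 0 + c₂ * u 1 + c₃ ∧
      g u 0 1 = c₄ * u 0 + c₁ * u 1 + c₅ ∧
      g u 1 0 = c₄ * u 0 + c₁ * u 1 + c₅ ∧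
      g u 1 1 = c₆ * u 0 + c₄ * u 1 + c₇) ∧
    c₁ * c₄ - c₂ * c₆ = 0 ∧ c₃ * c₄ - c₇ * c₂ = 0 ∧ c₃ * c₆ - c₁ * c₇ = 0

/-- Members of the seven-parameter family are the symmetric metrics with constant derivatives `p`
for which the two tensors entering the Jacobi identity are cyclically invariant. -/
theorem IsSevenParameter.exists_derivatives {U : Set (Fin 2 → ℝ)} (hU : IsOpen U)
    {g : (Fin 2 → ℝ) → Matrix (Fin 2) (Fin 2) ℝ} (h : IsSevenParameter U g) :
    ∃ p : Fin 2 → Fin 2 → Fin 2 → ℝ,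
      (∀ w ∈ U, ∀ i j, g w i j = g w j i) ∧ (∀ k i j, p k i j = p k j i) ∧
      (∀ w ∈ U, ∀ k i j, partialD k (fun w => g w i j) w = p k i j) ∧
      (∀ i j l, ∑ k, p k l i * !![0, 1; 1, 0] k j = ∑ k, p k i j * !![0, 1; 1, 0] k l) ∧
      ∀ w ∈ U, ∀ i j l, ∑ k, p k l i * g w k j = ∑ k, p k i j * g w k l := by
  obtain ⟨c₁, c₂, c₃, c₄, c₅, c₆, c₇, hc, h1, h2, h3⟩ := h
  refine ⟨fun k => ![!![c₁, c₄; c₄, c₆], !![c₂, c₁; c₁, c₄]] k, ?_, ?_, ?_, ?_, ?_⟩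
  · intro w hw i j
    obtain ⟨-, h01, h10, -⟩ := hc w hw
    fin_cases i <;> fin_cases j <;> simp [h01, h10]
  · intro k i j
    fin_cases k <;> fin_cases i <;> fin_cases j <;> simp
  · intro w hw k i j
    have h00 := partialD_affine hU (f := fun w => g w 0 0) (fun u hu => (hc u hu).1) hw
    have h01 := partialD_affine hU (f := fun w => g w 0 1) (fun u hu => (hc u hu).2.1) hw
    have h10 := partialD_affine hU (f := fun w => g w 1 0) (fun u hu => (hc u hu).2.2.1) hw
    have h11 := partialD_affine hU (f := fun w => g w 1 1) (fun u hu => (hc u hu).2.2.2) hw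
    fin_cases k <;> fin_cases i <;> fin_cases j <;> simp [h00, h01, h10, h11]
  · intro i j l
    fin_cases i <;> fin_cases j <;> fin_cases l <;> simp [Fin.sum_univ_two]
  · intro w hw i j l
    obtain ⟨h00, h01, h10, h11⟩ := hc w hw
    have r1 : c₄ * g w 0 0 = c₂ * g w 1 1 := by
      rw [h00, h11]
      linear_combination w 0 * h1 + h2
    have r2 : c₆ * g w 0 0 = c₁ * g w 1 1 := by
      rw [h00, h11]
      linear_combination -w 1 * h1 + h3
    have r3 : g w 1 0 = g w 0 1 := by rw [h10, h01]
    fin_cases i <;> fin_cases j <;> fin_cases l <;> simp [Fin.sum_univ_two, r3] <;> linarith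

theorem isSevenParameter_of_areCompatible {U : Set (Fin 2 → ℝ)} (hU : IsOpen U)
    (hUc : IsConnected U) {g : (Fin 2 → ℝ) → Matrix (Fin 2) (Fin 2) ℝ}
    {Γ : (Fin 2 → ℝ) → Fin 2 → Fin 2 → Fin 2 → ℝ}
    (hg : ∀ i j, ContDiffOn ℝ ∞ (fun u => g u i j) U)
    (hΓ : ∀ i j k, ContDiffOn ℝ ∞ (fun u => Γ u i j k) U)
    (hH : IsHamiltonian U (hydroOp g Γ)) (h : AreCompatible U (hydroOp g Γ) R31) :
    (∀ u ∈ U, ∀ i j k, Γ u i j k = 1 / 2 * partialD k (fun w => g w i j) u) ∧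
      IsSevenParameter U g := by
  have hcyc := fun w (hw : w ∈ U) => third_order_conditions hU hg hΓ h hw
    (D := fun i j l => ∑ k, partialD k (fun w => g w i j) w * !![0, 1; 1, 0] k l)
    (E := fun i j l => ∑ k, Γ w i j k * !![0, 1; 1, 0] k l) (fun _ _ _ => rfl) (fun _ _ _ => rfl)
  simp only [Fin.sum_univ_two] at hcyc
  have hΓg : ∀ u ∈ U, ∀ i j k, Γ u i j k = 1 / 2 * partialD k (fun w => g w i j) u := by
    intro w hw i j k
    have h0 := (hcyc w hw i j 0).1
    have h1 := (hcyc w hw i j 1).1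
    fin_cases k
    · simpa using h1
    · simpa using h0
  refine ⟨hΓg, ?_⟩
  obtain ⟨w₀, hw₀⟩ := hUc.nonempty
  have hconst : ∀ w ∈ U, ∀ i j k,
      partialD k (fun w => g w i j) w = partialD k (fun w => g w i j) w₀ := by
    intro w hw i j k
    have h0 := sum_partialD_eq hU hUc hg hΓ h hΓg i j 0 hw hw₀
    have h1 := sum_partialD_eq hU hUc hg hΓ h hΓg i j 1 hw hw₀
    fin_cases k
    · simpa [Fin.sum_univ_two] using h1
    · simpa [Fin.sum_univ_two] using h0
  have hs : ∀ w ∈ U, g w 1 0 = g w 0 1 := fun w hw => symm_of_skew hH hw 1 0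
  have hps : ∀ k, partialD k (fun w => g w 1 0) w₀ = partialD k (fun w => g w 0 1) w₀ := fun k => by
    have he : (fun w => g w 1 0) =ᶠ[𝓝 w₀] fun w => g w 0 1 := by
      filter_upwards [hU.mem_nhds hw₀] with w hw using hs w hw
    unfold partialD
    rw [he.fderiv_eq]
  have e1 : partialD 1 (fun w => g w 0 1) w₀ = partialD 0 (fun w => g w 0 0) w₀ := by
    simpa [hps] using (hcyc w₀ hw₀ 0 0 1).2
  have e2 : partialD 1 (fun w => g w 1 1) w₀ = partialD 0 (fun w => g w 0 1) w₀ := by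
    simpa [hps] using (hcyc w₀ hw₀ 1 1 0).2.symm
  obtain ⟨c₃, h00⟩ := exists_affine hU hUc (hg 0 0) (fun u hu => hconst u hu 0 0 0)
    (fun u hu => hconst u hu 0 0 1)
  obtain ⟨c₅, h01⟩ := exists_affine hU hUc (hg 0 1) (fun u hu => hconst u hu 0 1 0)
    (fun u hu => hconst u hu 0 1 1)
  obtain ⟨c₇, h11⟩ := exists_affine hU hUc (hg 1 1) (fun u hu => hconst u hu 1 1 0)
    (fun u hu => hconst u hu 1 1 1)
  have hT := fun w (hw : w ∈ U) => first_order_condition hU hg hΓ h hw (hΓg w hw)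
    (T := fun i j l => ∑ k, partialD k (fun w => g w i j) w * g w k l) (fun _ _ _ => rfl)
  simp only [Fin.sum_univ_two] at hT
  rw [e1] at h01
  rw [e2] at h11
  set c₁ := partialD 0 (fun w => g w 0 0) w₀
  set c₂ := partialD 1 (fun w => g w 0 0) w₀
  set c₄ := partialD 0 (fun w => g w 0 1) w₀
  set c₆ := partialD 0 (fun w => g w 1 1) w₀
  have q1 : c₄ * c₁ - c₂ * c₆ = 0 ∧ c₄ * c₂ - c₂ * c₄ = 0 ∧ c₄ * c₃ - c₂ * c₇ = 0 := by
    refine affine_eq_zero hU hUc.nonempty fun w hw => ?_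
    have := hT w hw 0 0 1
    rw [hconst w hw, hconst w hw, hconst w hw, hconst w hw, hps, hps, e1, hs w hw, h00 w hw,
      h11 w hw] at this
    linear_combination this
  have q2 : c₆ * c₁ - c₁ * c₆ = 0 ∧ c₆ * c₂ - c₁ * c₄ = 0 ∧ c₆ * c₃ - c₁ * c₇ = 0 := by
    refine affine_eq_zero hU hUc.nonempty fun w hw => ?_
    have := hT w hw 1 1 0
    rw [hconst w hw, hconst w hw, hconst w hw, hconst w hw, e1, e2, hs w hw, h00 w hw,
      h11 w hw] at this
    linear_combination -this
  refine ⟨c₁, c₂, c₃, c₄, c₅, c₆, c₇, fun u hu => ⟨h00 u hu, h01 u hu, ?_, h11 u hu⟩, ?_, ?_, ?_⟩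
  · rw [hs u hu, h01 u hu]
  · linarith [q1.1]
  · linarith [q1.2.2]
  · linarith [q2.2.2]

theorem IsSevenParameter.areCompatible {U : Set (Fin 2 → ℝ)} (hU : IsOpen U)
    {g : (Fin 2 → ℝ) → Matrix (Fin 2) (Fin 2) ℝ} {Γ : (Fin 2 → ℝ) → Fin 2 → Fin 2 → Fin 2 → ℝ}
    (hg : ∀ i j, ContDiffOn ℝ ∞ (fun u => g u i j) U)
    (hΓ : ∀ i j k, ContDiffOn ℝ ∞ (fun u => Γ u i j k) U) (h : IsSevenParameter U g)
    (hΓg : ∀ u ∈ U, ∀ i j k, Γ u i j k = 1 / 2 * partialD k (fun w => g w i j) u) :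
    AreCompatible U (hydroOp g Γ) R31 := by
  obtain ⟨p, hsymm, -, hp, hcA, hcg⟩ := h.exists_derivatives hU
  refine areCompatible_of_cyclic hU hg hΓ hsymm (fun i j => ?_) hp
    (fun w hw i j k => by rw [hΓg w hw, hp w hw]) hcA hcg
  fin_cases i <;> fin_cases j <;> rfl

theorem IsSevenParameter.contraChristoffel_eq {U : Set (Fin 2 → ℝ)} (hU : IsOpen U)
    {g : (Fin 2 → ℝ) → Matrix (Fin 2) (Fin 2) ℝ} (hg : ∀ i j, ContDiffOn ℝ ∞ (fun u => g u i j) U)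
    (h : IsSevenParameter U g) (hdet : ∀ u ∈ U, (g u).det ≠ 0) {u : Fin 2 → ℝ} (hu : u ∈ U)
    (i j k : Fin 2) :
    contraChristoffel g u i j k = 1 / 2 * partialD k (fun w => g w i j) u := by
  obtain ⟨p, hsymm, hps, hp, -, hcg⟩ := h.exists_derivatives hU
  rw [KdVType.contraChristoffel_eq hU hg hdet hsymm hps hp hcg hu, hp u hu]

theorem hamiltonian_and_compatible_iff {U : Set (Fin 2 → ℝ)} (hU : IsOpen U)
    (hUc : IsConnected U) {g : (Fin 2 → ℝ) → Matrix (Fin 2) (Fin 2) ℝ}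
    {Γ : (Fin 2 → ℝ) → Fin 2 → Fin 2 → Fin 2 → ℝ}
    (hg : ∀ i j, ContDiffOn ℝ ∞ (fun u => g u i j) U)
    (hΓ : ∀ i j k, ContDiffOn ℝ ∞ (fun u => Γ u i j k) U) :
    (IsHamiltonian U (hydroOp g Γ) ∧ AreCompatible U (hydroOp g Γ) R31) ↔
      (∀ u ∈ U, ∀ i j k, Γ u i j k = 1 / 2 * partialD k (fun w => g w i j) u) ∧
        IsSevenParameter U g := by
  refine ⟨fun h => isSevenParameter_of_areCompatible hU hUc hg hΓ h.1 h.2, fun h => ?_⟩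
  have hc := h.2.areCompatible hU hg hΓ h.1
  refine ⟨?_, hc⟩
  simpa using hc 1 0

end KdVType

theorem theorem2 (U : Set (Fin 2 → ℝ)) (hUo : IsOpen U) (hUc : IsConnected U)
    (g : (Fin 2 → ℝ) → Matrix (Fin 2) (Fin 2) ℝ)
    (Γ : (Fin 2 → ℝ) → Fin 2 → Fin 2 → Fin 2 → ℝ)
    (hg : ∀ i j, ContDiffOn ℝ ∞ (fun u => g u i j) U)
    (hΓ : ∀ i j k, ContDiffOn ℝ ∞ (fun u => Γ u i j k) U) :
    ((KdVType.IsHamiltonian U (KdVType.hydroOp g Γ) ∧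
        KdVType.AreCompatible U (KdVType.hydroOp g Γ) KdVType.R31) ↔
      ((∀ u ∈ U, ∀ i j k,
          Γ u i j k = (1 / 2) * KdVType.partialD k (fun w => g w i j) u) ∧
        ∃ c₁ c₂ c₃ c₄ c₅ c₆ c₇ : ℝ,
          (∀ u ∈ U,
            g u 0 0 = c₁ * u 0 + c₂ * u 1 + c₃ ∧
            g u 0 1 = c₄ * u 0 + c₁ * u 1 + c₅ ∧
            g u 1 0 = c₄ * u 0 + c₁ * u 1 + c₅ ∧
            g u 1 1 = c₆ * u 0 + c₄ * u 1 + c₇) ∧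
          c₁ * c₄ - c₂ * c₆ = 0 ∧ c₃ * c₄ - c₇ * c₂ = 0 ∧ c₃ * c₆ - c₁ * c₇ = 0)) ∧
    ((∀ u ∈ U, (g u).det ≠ 0) →
      ((KdVType.IsHamiltonian U (KdVType.hydroOp g Γ) ∧
          KdVType.AreCompatible U (KdVType.hydroOp g Γ) KdVType.R31) ↔
        ((∀ u ∈ U, ∀ i j k, Γ u i j k = KdVType.contraChristoffel g u i j k) ∧
          ∃ c₁ c₂ c₃ c₄ c₅ c₆ c₇ : ℝ,
            (∀ u ∈ U,
              g u 0 0 = c₁ * u 0 + c₂ * u 1 + c₃ ∧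
              g u 0 1 = c₄ * u 0 + c₁ * u 1 + c₅ ∧
              g u 1 0 = c₄ * u 0 + c₁ * u 1 + c₅ ∧
              g u 1 1 = c₆ * u 0 + c₄ * u 1 + c₇) ∧
            c₁ * c₄ - c₂ * c₆ = 0 ∧ c₃ * c₄ - c₇ * c₂ = 0 ∧
            c₃ * c₆ - c₁ * c₇ = 0))) := by

  have key := KdVType.hamiltonian_and_compatible_iff hUo hUc hg hΓ
  refine ⟨key, fun hdet => key.trans ⟨fun h => ⟨fun u hu i j k => ?_, h.2⟩,
    fun h => ⟨fun u hu i j k => ?_, h.2⟩⟩⟩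
  · rw [h.1 u hu, h.2.contraChristoffel_eq hUo hg hdet hu]
  · rw [h.1 u hu, KdVType.IsSevenParameter.contraChristoffel_eq hUo hg h.2 hdet hu]
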